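/- Let $\alpha>1$ and let $\mathcal M_\alpha$ be the class of functions $f:[0,\infty)\to\mathbb C$ that are twice continuously differentiable on $[0,\infty)$ and satisfy $f^{(j)}(x)=O(x^{-\alpha-j})$ as $x\to\infty$ for $j=0,1,2$. Let $f\in\mathcal M_\alpha$, let $k\ge 1$ be an integer, and write $f^*(s)=\int_0^\infty f(x)x^{s-1}\,dx$. Let $d_k(n)$ be the number of ways of writing $n$ as an ordered product of $k$ positive integers, let $$\gamma_m=\frac{(-1)^m}{m!}\lim_{l\to\infty}\left[\sum_{j=1}^{l}\frac{\log^m j}{j}-\frac{\log^{m+1}l}{m+1}\right],\qquad m\ge 0,$$ be the (normalised) Stieltjes constants, so that $\gamma_0$ is Euler's constant, and put $$P_{k-1}(x)=\frac{x^{k-1}}{(k-1)!}+\sum_{r=1}^{k-1}c_{k,r}\,x^{k-1-r},\qquad c_{k,r}=\frac{k!}{(k-1-r)!}\sum\frac{\gamma_0^{b_1}\gamma_1^{b_2}\cdots\gamma_{r-1}^{b_r}}{(k-n)!\,b_1!\,b_2!\cdots b_r!},$$ where the inner sum is over all tuples of nonnegative integers $(b_1,\dots,b_r)$ with $b_1+2b_2+\dots+rb_r=r$,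 and $n=b_1+\dots+b_r$. Then for every $x>0$ the series $\sum_{n\ge1}d_k(n)f(nx)$ and the integral $\int_0^\infty f(xy)P_{k-1}(\log y)\,dy$ converge absolutely, and for every complex $s$ with $\max\left(0,1-\frac2k\right)<\operatorname{Re}s<1$ $$\zeta(s)^k f^*(s)=\int_0^\infty x^{s-1}\left[\sum_{n=1}^\infty d_k(n)f(nx)-\int_0^\infty f(xy)P_{k-1}(\log y)\,dy\right]dx,$$ where the integral defining $f^*(s)$ and the outer integral on the right converge absolutely. -/

import Mathlib

open Filter Topology Asymptotics Set

namespace Muntz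

/-- The class `𝓜_α` (for `α > 1`): complex-valued functions on `[0, ∞)` that are twice continuously
differentiable on `[0, ∞)` (one-sided derivatives at `0`) and satisfy `f^(j)(x) = O(x^(-α-j))`
as `x → ∞` for `j = 0, 1, 2`. The values of `f` on the negative reals are irrelevant. -/
structure MuntzClass (α : ℝ) (f : ℝ → ℂ) : Prop where
  contDiffOn : ContDiffOn ℝ 2 f (Ici 0)
  isBigO : ∀ j : ℕ, j ≤ 2 →
    (fun x : ℝ => iteratedDerivWithin j f (Ici 0) x) =O[atTop] fun x : ℝ => x ^ (-α - (j : ℝ))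

/-- `d_k(n)`: the number of ways to write `n` as an ordered product of `k` positive factors. -/
def divisorFun (k n : ℕ) : ℕ := (Nat.finMulAntidiag k n).card

/-- The constants `γ_m` normalised as
`γ_m = (-1)^m / m! * lim_{l → ∞} (∑_{j=1}^l (log j)^m / j - (log l)^(m+1) / (m+1))`,
so that `γ_0` is Euler's constant. -/
noncomputable def stieltjes (m : ℕ) : ℝ :=
  (-1) ^ m / (m.factorial : ℝ) *
    limUnder atTop (fun l : ℕ =>
      ∑ j ∈ Finset.Icc 1 l, Real.log (j : ℝ) ^ m / (j : ℝ) -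
        Real.log (l : ℝ) ^ (m + 1) / ((m : ℝ) + 1))

/-- The tuples `(b_1, …, b_r)` of nonnegative integers with `b_1 + 2 b_2 + ⋯ + r b_r = r`;
`b_{i+1}` is `b i` for `i : Fin r`. -/
def weightedTuples (r : ℕ) : Finset (Fin r → ℕ) :=
  (Fintype.piFinset fun _ : Fin r => Finset.range (r + 1)).filter
    fun b => ∑ i : Fin r, ((i : ℕ) + 1) * b i = r

theorem mem_weightedTuples {r : ℕ} {b : Fin r → ℕ} :
    b ∈ weightedTuples r ↔ ∑ i : Fin r, ((i : ℕ) + 1) * b i = r := by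
  unfold weightedTuples
  rw [Finset.mem_filter, Fintype.mem_piFinset]
  refine ⟨fun h => h.2, fun h => ⟨fun i => ?_, h⟩⟩
  have h1 : ((i : ℕ) + 1) * b i ≤ ∑ i : Fin r, ((i : ℕ) + 1) * b i :=
    Finset.single_le_sum (f := fun i : Fin r => ((i : ℕ) + 1) * b i)
      (fun _ _ => Nat.zero_le _) (Finset.mem_univ i)
  rw [Finset.mem_range]
  nlinarith [Nat.zero_le ((i : ℕ) * b i)]

/-- `c_{k,r} = k! / (k-1-r)! * ∑ γ_0^{b_1} ⋯ γ_{r-1}^{b_r} / ((k-n)! b_1! ⋯ b_r!)`, the sum being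
over all `(b_1, …, b_r)` with `b_1 + 2 b_2 + ⋯ + r b_r = r`, and `n = b_1 + ⋯ + b_r`.
It is used only for `1 ≤ r ≤ k - 1`, where `n ≤ r < k` and no subtraction truncates. -/
noncomputable def coeffC (k r : ℕ) : ℝ :=
  (k.factorial : ℝ) / ((k - 1 - r).factorial : ℝ) *
    ∑ b ∈ weightedTuples r,
      (∏ i : Fin r, stieltjes (i : ℕ) ^ b i) /
        (((k - ∑ i, b i).factorial : ℝ) * ∏ i : Fin r, ((b i).factorial : ℝ))

/-- `P_{k-1}(X) = X^(k-1) / (k-1)! + ∑_{r=1}^{k-1} c_{k,r} X^(k-1-r)`, for `k ≥ 1`. -/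
noncomputable def polyP (k : ℕ) : Polynomial ℝ :=
  Polynomial.C (1 / ((k - 1).factorial : ℝ)) * Polynomial.X ^ (k - 1) +
    ∑ r ∈ Finset.Icc 1 (k - 1), Polynomial.C (coeffC k r) * Polynomial.X ^ (k - 1 - r)

/-- The function
`x ↦ ∑_{n ≥ 1} d_k(n) f(n x) - ∫_0^∞ f(x y) P_{k-1}(log y) dy`. -/
noncomputable def voronoi (k : ℕ) (f : ℝ → ℂ) (x : ℝ) : ℂ :=
  (∑' n : ℕ+, (divisorFun k (n : ℕ) : ℂ) * f (((n : ℕ) : ℝ) * x)) -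
    ∫ y in Ioi (0 : ℝ), f (x * y) * (((polyP k).eval (Real.log y) : ℝ) : ℂ)

end Muntz

/-! Everything is carried to the Mellin side. Fix `c` in `(1, α)`. Mellin inversion of `f`,
superposed over dilates, writes `∑ d_k(n) f(nx)` as the inverse Mellin transform of `f* ζ^k` on `Re
s = c`. Since `∫ (log y)^j y^(-s) dy` over `(1, ∞)` is `j!/(s-1)^(j+1)`, the same device writes the
part of the integral over `y > 1` as the inverse transform of `f*` times the polar part of `ζ^k` at
`1`: the coefficients `c_{k,r}` are the Laurent coefficients of `ζ^k` up to factorials. The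
difference is the inverse transform of `f* H` with `H = ζ^k - polar part` entire, so the line can be
moved to some `σ < 1` without a residue. On that line the part over `0 < y ≤ 1` becomes available
and contributes minus the polar part, so that subtracting it restores `f* ζ^k`. This is
`MuntzClass.voronoi_eq_mellinInv`.

The shift needs `f* H` to be integrable on vertical lines, uniformly in the strip. Two integrations
by parts give `f*(s) = O(|t|^(-2))` (`MuntzClass.exists_norm_mellin_le`), and the convexity bound
gives `ζ(s) = O(|t|^((1-σ)/2+ε))` (`exists_norm_riemannZeta_le`). The product decays faster than
`1/|t|` exactly when `k(1-σ)/2 < 1` for small `ε`, which is the condition `σ > 1 - 2/k`.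

Finally the inverse transform is inverted by `hasMellin_of_eq_mellinInv`. The representation on
every line of an open strip gives a bound `x^(-σ)` for each `σ` there, hence absolute convergence of
the Mellin integral, and Fourier inversion gives its value. -/

namespace Muntz

open MeasureTheory Complex

/-! ### Mellin inversion, superposition of dilates and contour shift. -/

section MellinMachinery

theorem norm_ofReal_cpow_neg_add_mul_I {x : ℝ} (hx : 0 < x) (σ t : ℝ) :
    ‖(x : ℂ) ^ (-(σ + t * I) : ℂ)‖ = x ^ (-σ) := by
  rw [norm_cpow_eq_rpow_re_of_pos hx]
  simp

theorem verticalIntegrable_of_norm_le {Φ : ℂ → ℂ} {σ C r : ℝ} (hr : 1 < r)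
    (hc : Continuous fun t : ℝ => Φ (σ + t * I))
    (hb : ∀ t : ℝ, ‖Φ (σ + t * I)‖ ≤ C * (1 + |t|) ^ (-r)) :
    VerticalIntegrable Φ σ := by
  have h : Integrable (fun t : ℝ => C * (1 + ‖t‖) ^ (-r)) :=
    (integrable_one_add_norm (by simpa using hr)).const_mul C
  exact h.mono' hc.aestronglyMeasurable (Eventually.of_forall hb)

theorem integrable_cpow_smul {Φ : ℂ → ℂ} {σ : ℝ} (h : VerticalIntegrable Φ σ) {x : ℝ}
    (hx : 0 < x) :
    Integrable fun t : ℝ => (x : ℂ) ^ (-(σ + t * I) : ℂ) • Φ (σ + t * I) := by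
  refine Integrable.mono (h.const_mul ((x : ℂ) ^ (-σ : ℂ))) ?_ (Eventually.of_forall fun t => ?_)
  · simp only [smul_eq_mul]
    refine AEStronglyMeasurable.mul ?_ (Integrable.aestronglyMeasurable h)
    exact (Continuous.const_cpow (by fun_prop)
      (Or.inl (by exact_mod_cast hx.ne'))).aestronglyMeasurable
  · rw [norm_smul, norm_mul, norm_ofReal_cpow_neg_add_mul_I hx]
    have := norm_ofReal_cpow_neg_add_mul_I hx σ 0
    simp only [ofReal_zero, zero_mul, add_zero] at this
    rw [this]

theorem mellinInv_sub {Φ Ψ : ℂ → ℂ} {σ : ℝ} (h₁ : VerticalIntegrable Φ σ)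
    (h₂ : VerticalIntegrable Ψ σ) {x : ℝ} (hx : 0 < x) :
    mellinInv σ (fun s => Φ s - Ψ s) x = mellinInv σ Φ x - mellinInv σ Ψ x := by
  simp only [mellinInv, smul_sub]
  rw [integral_sub (integrable_cpow_smul h₁ hx) (integrable_cpow_smul h₂ hx), smul_sub]

/-- The integrand of the double integral behind `integral_comp_mul_eq_mellinInv`. -/
theorem integrable_prod_cpow_mul {Y : Type*} [MeasurableSpace Y] {μ : Measure Y} [SFinite μ]
    {F : ℂ → ℂ} {σ : ℝ} (hF : VerticalIntegrable F σ)
    {w : Y → ℂ} {p : Y → ℝ} (hw : AEStronglyMeasurable w μ) (hp : Measurable p)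
    (hpos : ∀ᵐ y ∂μ, 0 < p y) (hint : Integrable (fun y => w y * (p y : ℂ) ^ (-σ : ℂ)) μ)
    {x : ℝ} (hx : 0 < x) :
    Integrable (fun z : Y × ℝ =>
      w z.1 * (((x * p z.1 : ℝ) : ℂ) ^ (-(σ + z.2 * I) : ℂ) * F (σ + z.2 * I)))
      (μ.prod volume) := by
  refine Integrable.mono ((hint.mul_prod hF).const_mul ((x ^ (-σ) : ℝ) : ℂ)) ?_ ?_
  · refine AEStronglyMeasurable.mul hw.comp_fst (AEStronglyMeasurable.mul ?_ ?_)
    · refine Measurable.aestronglyMeasurable ?_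
      have : Measurable fun z : Y × ℝ => p z.1 := hp.comp measurable_fst
      fun_prop
    · exact hF.aestronglyMeasurable.comp_snd
  · filter_upwards [Measure.quasiMeasurePreserving_fst.ae hpos] with z hz
    have h0 := norm_ofReal_cpow_neg_add_mul_I hz σ 0
    simp only [ofReal_zero, zero_mul, add_zero] at h0
    rw [norm_mul, norm_mul, norm_ofReal_cpow_neg_add_mul_I (mul_pos hx hz), norm_mul, norm_mul,
      norm_mul, h0, Real.mul_rpow hx.le hz.le, norm_real,
      Real.norm_of_nonneg (Real.rpow_nonneg hx.le _)]
    apply le_of_eq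
    ring

/-- Superposing dilates of `f` multiplies the Mellin transform by `∫ w y * p y ^ (-s)`. -/
theorem integral_comp_mul_eq_mellinInv {Y : Type*} [MeasurableSpace Y] {μ : Measure Y} [SFinite μ]
    {f : ℝ → ℂ} {σ : ℝ} (hf : MellinConvergent f σ) (hF : VerticalIntegrable (mellin f) σ)
    (hc : ContinuousOn f (Ioi 0))
    {w : Y → ℂ} {p : Y → ℝ} (hw : AEStronglyMeasurable w μ) (hp : Measurable p)
    (hpos : ∀ᵐ y ∂μ, 0 < p y) (hint : Integrable (fun y => w y * (p y : ℂ) ^ (-σ : ℂ)) μ)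
    {x : ℝ} (hx : 0 < x) :
    Integrable (fun y => w y * f (x * p y)) μ ∧
    VerticalIntegrable (fun s => mellin f s * ∫ y, w y * (p y : ℂ) ^ (-s) ∂μ) σ ∧
    ∫ y, w y * f (x * p y) ∂μ =
      mellinInv σ (fun s => mellin f s * ∫ y, w y * (p y : ℂ) ^ (-s) ∂μ) x := by
  have hG := integrable_prod_cpow_mul hF hw hp hpos hint hx
  have hG1 := integrable_prod_cpow_mul hF hw hp hpos hint one_pos
  have h2π : (2 * Real.pi : ℝ) ≠ 0 := by positivity
  have inner : ∀ᵐ y ∂μ, (1 / (2 * Real.pi)) • (∫ t : ℝ,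
      w y * (((x * p y : ℝ) : ℂ) ^ (-(σ + t * I) : ℂ) * mellin f (σ + t * I))) =
        w y * f (x * p y) := by
    filter_upwards [hpos] with y hy
    have := mellinInv_mellin_eq σ f (mul_pos hx hy) hf hF
      (hc.continuousAt (Ioi_mem_nhds (mul_pos hx hy)))
    rw [← this, mellinInv, integral_const_mul, mul_smul_comm]
    simp only [smul_eq_mul]
  refine ⟨?_, ?_, ?_⟩
  · exact (hG.integral_prod_left.smul (1 / (2 * Real.pi))).congr inner
  · refine hG1.integral_prod_right.congr (Eventually.of_forall fun t => ?_)
    simp only [one_mul]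
    rw [← integral_const_mul]
    congr 1
    ext y
    ring
  · rw [← integral_congr_ae inner, integral_smul,
      integral_integral_swap (f := fun (y : Y) (t : ℝ) =>
        w y * (((x * p y : ℝ) : ℂ) ^ (-(σ + t * I) : ℂ) * mellin f (σ + t * I))) hG, mellinInv]
    congr 2
    ext t
    rw [smul_eq_mul, ← integral_const_mul, ← integral_const_mul]
    refine integral_congr_ae ?_
    filter_upwards [hpos] with y hy
    rw [ofReal_mul, mul_cpow_ofReal_nonneg hx.le hy.le]
    ring

theorem integral_vertical_eq_of_norm_le {Φ : ℂ → ℂ} {a b C r : ℝ} (hab : a ≤ b) (hr : 1 < r)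
    (hd : DifferentiableOn ℂ Φ (re ⁻¹' Icc a b))
    (hb : ∀ s : ℂ, a ≤ s.re → s.re ≤ b → ‖Φ s‖ ≤ C * (1 + |s.im|) ^ (-r)) :
    ∫ t : ℝ, Φ (a + t * I) = ∫ t : ℝ, Φ (b + t * I) := by
  have cont : ∀ σ ∈ Icc a b, Continuous fun t : ℝ => Φ (σ + t * I) := fun σ hσ =>
    hd.continuousOn.comp_continuous (by fun_prop) fun t => by simpa using hσ
  have hint : ∀ σ ∈ Icc a b, Integrable fun t : ℝ => Φ (σ + t * I) := fun σ hσ =>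
    verticalIntegrable_of_norm_le hr (cont σ hσ) fun t => by
      simpa using hb (σ + t * I) (by simpa using hσ.1) (by simpa using hσ.2)
  have lim : ∀ σ ∈ Icc a b, Tendsto (fun T : ℝ => ∫ t in (-T)..T, Φ (σ + t * I)) atTop
      (𝓝 (∫ t : ℝ, Φ (σ + t * I))) := fun σ hσ =>
    intervalIntegral_tendsto_integral (hint σ hσ) tendsto_neg_atTop_atBot tendsto_id
  have hdiff := (lim b ⟨hab, le_rfl⟩).sub (lim a ⟨le_rfl, hab⟩)
  have hzero : Tendsto (fun T : ℝ => (∫ t in (-T)..T, Φ (b + t * I)) -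
      ∫ t in (-T)..T, Φ (a + t * I)) atTop (𝓝 0) := by
    have hdecay : Tendsto (fun T : ℝ => 2 * (C * (1 + T) ^ (-r) * |b - a|)) atTop (𝓝 0) := by
      have h1 : Tendsto (fun T : ℝ => (1 + T) ^ (-r)) atTop (𝓝 0) :=
        (tendsto_rpow_neg_atTop (by linarith)).comp (tendsto_atTop_add_const_left _ 1 tendsto_id)
      simpa using ((h1.const_mul C).mul_const |b - a|).const_mul 2
    refine squeeze_zero_norm' ?_ hdecay
    filter_upwards [eventually_ge_atTop 0] with T hT
    have hrect := integral_boundary_rect_eq_zero_of_differentiableOn Φ (a + (-T : ℝ) * I)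
      (b + T * I) (hd.mono fun z hz => by
        have := hz.1
        simp only [add_re, ofReal_re, mul_re, I_re, mul_zero, ofReal_im, I_im, mul_one, sub_self,
          add_zero, uIcc_of_le hab] at this
        exact this)
    simp only [add_re, ofReal_re, mul_re, I_re, mul_zero, ofReal_im, I_im, mul_one, sub_self,
      add_zero, add_im, mul_im, zero_add] at hrect
    have hor : ∀ τ : ℝ, |τ| = T → ‖∫ x in a..b, Φ (x + τ * I)‖ ≤ C * (1 + T) ^ (-r) * |b - a| := by
      intro τ hτ
      refine intervalIntegral.norm_integral_le_of_norm_le_const fun x hx => ?_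
      rw [uIoc_of_le hab] at hx
      have := hb (x + τ * I) (by simpa using hx.1.le) (by simpa using hx.2)
      simpa [hτ] using this
    have e : I • ((∫ t in (-T)..T, Φ (b + t * I)) - ∫ t in (-T)..T, Φ (a + t * I)) =
        (∫ x in a..b, Φ (x + T * I)) - ∫ x in a..b, Φ (x + (-T : ℝ) * I) := by
      rw [smul_sub]
      linear_combination hrect
    have en : ‖(∫ t in (-T)..T, Φ (b + t * I)) - ∫ t in (-T)..T, Φ (a + t * I)‖ =
        ‖(∫ x in a..b, Φ (x + T * I)) - ∫ x in a..b, Φ (x + (-T : ℝ) * I)‖ := by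
      rw [← e, norm_smul, norm_I, one_mul]
    rw [en]
    refine (norm_sub_le _ _).trans ?_
    have h1 := hor T (abs_of_nonneg hT)
    have h2 := hor (-T) (by rw [abs_neg, abs_of_nonneg hT])
    linarith
  exact (sub_eq_zero.mp (tendsto_nhds_unique hdiff hzero)).symm

/-- Shifting the line of integration of an inverse Mellin transform. -/
theorem mellinInv_eq_of_norm_le {Φ : ℂ → ℂ} {a b C r : ℝ} (hab : a ≤ b) (hr : 1 < r)
    (hd : DifferentiableOn ℂ Φ (re ⁻¹' Icc a b))
    (hb : ∀ s : ℂ, a ≤ s.re → s.re ≤ b → ‖Φ s‖ ≤ C * (1 + |s.im|) ^ (-r)) {x : ℝ} (hx : 0 < x) :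
    mellinInv a Φ x = mellinInv b Φ x := by
  have hx0 : (x : ℂ) ≠ 0 := by exact_mod_cast hx.ne'
  rw [mellinInv, mellinInv]
  congr 1
  refine integral_vertical_eq_of_norm_le (Φ := fun s => (x : ℂ) ^ (-s) * Φ s)
    -- For `a ≤ Re s ≤ b` the factor `x^(-Re s)` is at most `x^(-a)` or `x^(-b)`, according as `x ≤
    -- 1` or `x ≥ 1` is reversed or not; the sum covers both cases.
    (C := (x ^ (-a) + x ^ (-b)) * C) hab hr ?_ ?_
  · refine DifferentiableOn.mul (fun s _ => ?_) hd
    exact ((differentiableAt_id.neg).const_cpow (Or.inl hx0)).differentiableWithinAt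
  · intro s h1 h2
    rw [norm_mul, norm_cpow_eq_rpow_re_of_pos hx, mul_assoc, neg_re]
    refine mul_le_mul ?_ (hb s h1 h2) (norm_nonneg _) (by positivity)
    rcases le_total 1 x with h | h
    · have := Real.rpow_le_rpow_of_exponent_le h (neg_le_neg h1)
      have := Real.rpow_nonneg hx.le (-b)
      linarith
    · have := Real.rpow_le_rpow_of_exponent_ge hx h (neg_le_neg h2)
      have := Real.rpow_nonneg hx.le (-a)
      linarith

/-- Turns each admissible line of integration into a growth bound valid for all `x > 0`. -/
theorem norm_mellinInv_le {Φ : ℂ → ℂ} {σ x : ℝ} (hx : 0 < x) :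
    ‖mellinInv σ Φ x‖ ≤ (1 / (2 * Real.pi) * ∫ t : ℝ, ‖Φ (σ + t * I)‖) * x ^ (-σ) := by
  rw [mellinInv, norm_smul, Real.norm_of_nonneg (by positivity), mul_assoc]
  refine mul_le_mul_of_nonneg_left ?_ (by positivity)
  refine (norm_integral_le_integral_norm _).trans (le_of_eq ?_)
  rw [← integral_mul_const]
  congr 1
  ext t
  rw [norm_smul, norm_ofReal_cpow_neg_add_mul_I hx, mul_comm]

open scoped FourierTransform in
-- With `x = exp(-u)` this is Fourier inversion for `h(y) = Φ(Re s + 2πiy)`. Inversion needs the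
-- transform of `h` to be integrable, and this is where having a whole open strip of lines matters:
-- lines to the left and to the right of `Re s` give exponential decay at the two ends.
theorem hasMellin_of_eq_mellinInv {g : ℝ → ℂ} {Φ : ℂ → ℂ} {a b : ℝ}
    (hcont : ∀ σ ∈ Ioo a b, Continuous fun t : ℝ => Φ (σ + t * I))
    (hint : ∀ σ ∈ Ioo a b, VerticalIntegrable Φ σ)
    (hg : ∀ σ ∈ Ioo a b, ∀ x : ℝ, 0 < x → g x = mellinInv σ Φ x)
    {s : ℂ} (ha : a < s.re) (hb : s.re < b) : HasMellin g s (Φ s) := by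
  have h2π : (2 * Real.pi : ℝ) ≠ 0 := by positivity
  set h : ℝ → ℂ := fun y => Φ (s.re + 2 * Real.pi * y * I) with hh
  have hcomp : h = (fun t : ℝ => Φ (s.re + t * I)) ∘ fun y : ℝ => y * (2 * Real.pi) := by
    ext y
    simp only [hh, Function.comp]
    push_cast
    ring_nf
  have hhc : Continuous h := by
    rw [hcomp]
    exact (hcont s.re ⟨ha, hb⟩).comp (by fun_prop)
  have hhi : Integrable h := by
    rw [hcomp]
    exact (hint s.re ⟨ha, hb⟩).comp_mul_right' h2π
  have hgx : ∀ x : ℝ, 0 < x → g x = (x : ℂ) ^ (-s.re : ℂ) * 𝓕⁻ h (-Real.log x) := fun x hx => by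
    rw [hg s.re ⟨ha, hb⟩ x hx, mellinInv_eq_fourierInv _ _ hx, smul_eq_mul]
  have hFc : Continuous (𝓕⁻ h) := by
    rw [Real.fourierInv_eq_fourier_comp_neg]
    exact VectorFourier.fourierIntegral_continuous Real.continuous_fourierChar
      (by exact continuous_inner) hhi.comp_neg
  have hgc : ContinuousOn g (Ioi 0) := by
    refine ContinuousOn.congr (f := fun x : ℝ => (x : ℂ) ^ (-s.re : ℂ) * 𝓕⁻ h (-Real.log x)) ?_
      fun x hx => hgx x hx
    refine ContinuousOn.mul ?_ ?_
    · exact fun x hx => (continuousAt_ofReal_cpow_const _ _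
        (Or.inr (ne_of_gt hx))).continuousWithinAt
    · exact hFc.comp_continuousOn (Real.continuousOn_log.mono fun x hx => ne_of_gt hx).neg
  have hbound : ∀ σ ∈ Ioo a b, ∃ C : ℝ, ∀ x : ℝ, 0 < x → ‖g x‖ ≤ C * ‖x ^ (-σ)‖ := fun σ hσ =>
    ⟨_, fun x hx => by
      rw [hg σ hσ x hx, Real.norm_of_nonneg (Real.rpow_nonneg hx.le _)]
      exact norm_mellinInv_le hx⟩
  have hconv : MellinConvergent g s := by
    obtain ⟨C₁, h₁⟩ := hbound ((s.re + b) / 2) ⟨by linarith, by linarith⟩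
    obtain ⟨C₂, h₂⟩ := hbound ((s.re + a) / 2) ⟨by linarith, by linarith⟩
    refine mellinConvergent_of_isBigO_rpow (hgc.locallyIntegrableOn measurableSet_Ioi)
      (a := (s.re + b) / 2) (b := (s.re + a) / 2) ?_ (by linarith) ?_ (by linarith)
    · exact IsBigO.of_bound C₁ ((eventually_gt_atTop 0).mono fun x hx => h₁ x hx)
    · exact IsBigO.of_bound C₂ (eventually_mem_nhdsWithin.mono fun x hx => h₂ x hx)
  have hexp : ∀ u : ℝ, Real.exp (-s.re * u) • g (Real.exp (-u)) = 𝓕⁻ h u := fun u => by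
    rw [hgx _ (Real.exp_pos _), Real.log_exp, neg_neg, ofReal_exp, ← ofReal_neg,
      cpow_def_of_ne_zero (exp_ne_zero _), ← ofReal_exp, ← ofReal_log (Real.exp_pos _).le,
      Real.log_exp, real_smul, ofReal_exp, ← mul_assoc, ← Complex.exp_add]
    push_cast
    ring_nf
    simp
  have hFi : Integrable (𝓕⁻ h) := by
    obtain ⟨δ, hδ, h1, h2⟩ : ∃ δ : ℝ, 0 < δ ∧ a < s.re - δ ∧ s.re + δ < b :=
      ⟨min (s.re - a) (b - s.re) / 2, by
        have : 0 < min (s.re - a) (b - s.re) := lt_min (by linarith) (by linarith)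
        linarith, by
        have := min_le_left (s.re - a) (b - s.re)
        linarith, by
        have := min_le_right (s.re - a) (b - s.re)
        linarith⟩
    obtain ⟨C₁, hC₁⟩ := hbound (s.re - δ) ⟨by linarith, by linarith⟩
    obtain ⟨C₂, hC₂⟩ := hbound (s.re + δ) ⟨by linarith, by linarith⟩
    -- A line to the right of `Re s` controls `u → -∞`, one to the left controls `u → +∞`.
    have key : ∀ (σ C u : ℝ), (∀ x : ℝ, 0 < x → ‖g x‖ ≤ C * ‖x ^ (-σ)‖) →
        ‖𝓕⁻ h u‖ ≤ C * Real.exp ((σ - s.re) * u) := fun σ C u hC => by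
      rw [← hexp, norm_smul, Real.norm_of_nonneg (Real.exp_pos _).le]
      refine (mul_le_mul_of_nonneg_left (hC _ (Real.exp_pos _)) (Real.exp_pos _).le).trans ?_
      rw [Real.norm_of_nonneg (by positivity), ← Real.exp_mul, mul_left_comm, ← Real.exp_add]
      apply le_of_eq
      ring_nf
    rw [← integrableOn_univ, ← Iic_union_Ioi (a := (0 : ℝ))]
    refine IntegrableOn.union ?_ ?_
    · refine Integrable.mono' (g := fun u => C₂ * Real.exp (δ * u)) ?_
        hFc.aestronglyMeasurable (Eventually.of_forall fun u => ?_)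
      · exact (integrableOn_exp_mul_Iic hδ 0).const_mul C₂
      · simpa using key _ _ u hC₂
    · refine Integrable.mono' (g := fun u => C₁ * Real.exp (-δ * u)) ?_
        hFc.aestronglyMeasurable (Eventually.of_forall fun u => ?_)
      · exact (integrableOn_exp_mul_Ioi (neg_neg_of_pos hδ) 0).const_mul C₁
      · simpa using key _ _ u hC₁
  refine ⟨hconv, ?_⟩
  rw [mellin_eq_fourier]
  simp_rw [hexp]
  rw [hhi.fourier_fourierInv_eq ?_ hhc.continuousAt]
  · simp only [hh]
    congr 1
    have : (Real.pi : ℂ) ≠ 0 := by exact_mod_cast Real.pi_ne_zero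
    push_cast
    rw [mul_div_cancel₀ _ (mul_ne_zero two_ne_zero this)]
    exact re_add_im s
  · have : 𝓕 h = fun u => 𝓕⁻ h (-u) := by
      ext u
      rw [Real.fourierInv_eq_fourier_neg, neg_neg]
    rw [this]
    exact hFi.comp_neg

end MellinMachinery

end Muntz

namespace Muntz

open MeasureTheory Complex

/-! ### Mellin transforms of continuous functions with power decay. -/

section MellinOfDecay

variable {g h : ℝ → ℂ} {β : ℝ} {s : ℂ}

theorem isBigO_nhdsGT_zero_of_continuousOn (hg : ContinuousOn g (Ici 0)) :
    g =O[𝓝[>] 0] fun x : ℝ => x ^ (-0 : ℝ) := by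
  simp only [neg_zero, Real.rpow_zero]
  exact (((hg 0 self_mem_Ici).mono Ioi_subset_Ici_self).tendsto).isBigO_one ℝ

theorem locallyIntegrableOn_of_continuousOn (hg : ContinuousOn g (Ici 0)) :
    LocallyIntegrableOn g (Ioi 0) :=
  (hg.mono Ioi_subset_Ici_self).locallyIntegrableOn measurableSet_Ioi

theorem mellinConvergent_of_continuousOn (hg : ContinuousOn g (Ici 0))
    (hO : g =O[atTop] fun x : ℝ => x ^ (-β)) (h0 : 0 < s.re) (hβ : s.re < β) :
    MellinConvergent g s :=
  mellinConvergent_of_isBigO_rpow (locallyIntegrableOn_of_continuousOn hg) hO hβ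
    (isBigO_nhdsGT_zero_of_continuousOn hg) h0

/-- Integration by parts; the boundary term `x^s g(x)` vanishes at `0` because `Re s > 0` and at
infinity because `Re s < β`. -/
theorem mellin_add_one_eq_of_hasDerivAt (hg : ContinuousOn g (Ici 0)) (hh : ContinuousOn h (Ici 0))
    (hd : ∀ x ∈ Ioi (0 : ℝ), HasDerivAt g (h x) x)
    (hgO : g =O[atTop] fun x : ℝ => x ^ (-β)) (hhO : h =O[atTop] fun x : ℝ => x ^ (-(β + 1)))
    (h0 : 0 < s.re) (hβ : s.re < β) : mellin h (s + 1) = -s * mellin g s := by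
  have hs0 : s ≠ 0 := fun e => by simp [e] at h0
  have hgM : MellinConvergent g s := mellinConvergent_of_continuousOn hg hgO h0 hβ
  have hhM : MellinConvergent h (s + 1) :=
    mellinConvergent_of_continuousOn hh hhO (by simp; linarith) (by simp; linarith)
  have hnorm : ∀ x : ℝ, 0 < x → ‖(x : ℂ) ^ s‖ = x ^ s.re := fun x hx =>
    norm_cpow_eq_rpow_re_of_pos hx s
  have hparts := integral_Ioi_mul_deriv_eq_deriv_mul (a := (0 : ℝ)) (a' := (0 : ℂ)) (b' := (0 : ℂ))
    (u := fun x : ℝ => (x : ℂ) ^ s) (v := g) (u' := fun x : ℝ => s * (x : ℂ) ^ (s - 1)) (v' := h)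
    (fun x hx => hasDerivAt_ofReal_cpow_const (ne_of_gt hx) hs0) hd ?_ ?_ ?_ ?_
  · simp only [mellin, add_sub_cancel_right, smul_eq_mul]
    rw [hparts, ← integral_const_mul]
    simp only [sub_self, zero_sub, ← integral_neg]
    congr 1
    ext x
    ring
  · simpa [MellinConvergent, smul_eq_mul] using! hhM
  · have : IntegrableOn (fun x : ℝ => s * ((x : ℂ) ^ (s - 1) • g x)) (Ioi 0) :=
      Integrable.const_mul hgM s
    refine this.congr_fun (fun x _ => ?_) measurableSet_Ioi
    simp [mul_assoc]
  · have h1 : Tendsto (fun x : ℝ => (x : ℂ) ^ s) (𝓝[>] 0) (𝓝 0) := by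
      have := (continuousAt_ofReal_cpow_const 0 s (Or.inl h0)).tendsto
      rw [ofReal_zero, zero_cpow hs0] at this
      exact this.mono_left nhdsWithin_le_nhds
    have h2 := ((hg 0 self_mem_Ici).mono Ioi_subset_Ici_self).tendsto
    simpa using! h1.mul h2
  · have h1 : (fun x : ℝ => (x : ℂ) ^ s * g x) =O[atTop] fun x : ℝ => x ^ (s.re) * x ^ (-β) := by
      refine IsBigO.mul (IsBigO.of_bound 1 ?_) hgO
      filter_upwards [eventually_gt_atTop 0] with x hx
      rw [hnorm x hx, Real.norm_of_nonneg (Real.rpow_nonneg hx.le _), one_mul]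
    refine h1.trans_tendsto ?_
    have h2 : Tendsto (fun x : ℝ => x ^ (-(β - s.re))) atTop (𝓝 0) :=
      tendsto_rpow_neg_atTop (by linarith)
    refine h2.congr' ?_
    filter_upwards [eventually_gt_atTop 0] with x hx
    rw [← Real.rpow_add hx]
    ring_nf

theorem exists_norm_mellin_le {a b : ℝ} (ha : MellinConvergent g a) (hb : MellinConvergent g b) :
    ∃ C : ℝ, 0 ≤ C ∧ ∀ s : ℂ, a ≤ s.re → s.re ≤ b → ‖mellin g s‖ ≤ C := by
  have key : ∀ σ : ℝ, MellinConvergent g σ →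
      IntegrableOn (fun x : ℝ => x ^ (σ - 1) * ‖g x‖) (Ioi 0) := fun σ hσ => by
    refine (Integrable.norm hσ).congr ?_
    filter_upwards [ae_restrict_mem measurableSet_Ioi] with x hx
    rw [norm_smul, norm_cpow_eq_rpow_re_of_pos hx]
    simp
  have hint := (key a ha).add (key b hb)
  refine ⟨_, integral_nonneg_of_ae (f := fun x : ℝ => x ^ (a - 1) * ‖g x‖ + x ^ (b - 1) * ‖g x‖)
    (μ := volume.restrict (Ioi 0)) ?_, fun s h1 h2 => norm_integral_le_of_norm_le hint ?_⟩
  · filter_upwards [ae_restrict_mem measurableSet_Ioi] with x hx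
    have hx' : (0 : ℝ) < x := hx
    simp only [Pi.zero_apply]
    positivity
  · filter_upwards [ae_restrict_mem measurableSet_Ioi] with x hx
    have hx' : (0 : ℝ) < x := hx
    rw [norm_smul, norm_cpow_eq_rpow_re_of_pos hx']
    simp only [sub_re, one_re, ← add_mul]
    refine mul_le_mul_of_nonneg_right ?_ (norm_nonneg _)
    rcases le_total 1 x with h | h
    · have := Real.rpow_le_rpow_of_exponent_le h (show s.re - 1 ≤ b - 1 by linarith)
      have := Real.rpow_nonneg hx'.le (a - 1)
      linarith
    · have := Real.rpow_le_rpow_of_exponent_ge hx' h (show a - 1 ≤ s.re - 1 by linarith)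
      have := Real.rpow_nonneg hx'.le (b - 1)
      linarith

end MellinOfDecay

/-! ### Quadratic decay of the Mellin transform on the class `𝓜_α`. -/

section MuntzClass

variable {α : ℝ} {f : ℝ → ℂ}

theorem MuntzClass.continuousOn_iteratedDerivWithin (hf : MuntzClass α f) {j : ℕ} (hj : j ≤ 2) :
    ContinuousOn (iteratedDerivWithin j f (Ici 0)) (Ici 0) :=
  hf.contDiffOn.continuousOn_iteratedDerivWithin (by exact_mod_cast hj) (uniqueDiffOn_Ici 0)

theorem MuntzClass.hasDerivAt_iteratedDerivWithin (hf : MuntzClass α f) {j : ℕ} (hj : j < 2)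
    {x : ℝ} (hx : x ∈ Ioi (0 : ℝ)) :
    HasDerivAt (iteratedDerivWithin j f (Ici 0)) (iteratedDerivWithin (j + 1) f (Ici 0) x) x := by
  have h := (hf.contDiffOn.differentiableOn_iteratedDerivWithin (m := j) (by exact_mod_cast hj)
    (uniqueDiffOn_Ici 0) x (Ioi_subset_Ici_self hx)).hasDerivWithinAt
  rw [iteratedDerivWithin_succ]
  exact h.hasDerivAt (Ici_mem_nhds hx)

theorem MuntzClass.continuousOn (hf : MuntzClass α f) : ContinuousOn f (Ici 0) :=
  hf.contDiffOn.continuousOn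

theorem MuntzClass.isBigO_rpow (hf : MuntzClass α f) : f =O[atTop] fun x : ℝ => x ^ (-α) := by
  simpa using hf.isBigO 0 (by norm_num)

theorem MuntzClass.mellinConvergent (hf : MuntzClass α f) {s : ℂ} (h0 : 0 < s.re)
    (hα : s.re < α) : MellinConvergent f s :=
  mellinConvergent_of_continuousOn hf.continuousOn hf.isBigO_rpow h0 hα

theorem MuntzClass.differentiableAt_mellin (hf : MuntzClass α f) {s : ℂ} (h0 : 0 < s.re)
    (hα : s.re < α) : DifferentiableAt ℂ (mellin f) s :=
  mellin_differentiableAt_of_isBigO_rpow (locallyIntegrableOn_of_continuousOn hf.continuousOn)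
    hf.isBigO_rpow hα (isBigO_nhdsGT_zero_of_continuousOn hf.continuousOn) h0

theorem MuntzClass.mellin_iteratedDerivWithin_two (hf : MuntzClass α f) {s : ℂ} (h0 : 0 < s.re)
    (hα : s.re < α) :
    mellin (iteratedDerivWithin 2 f (Ici 0)) (s + 2) = s * (s + 1) * mellin f s := by
  have e1 := mellin_add_one_eq_of_hasDerivAt (β := α)
    (hf.continuousOn_iteratedDerivWithin (j := 0) (by norm_num))
    (hf.continuousOn_iteratedDerivWithin (j := 1) (by norm_num))
    (fun x hx => hf.hasDerivAt_iteratedDerivWithin (j := 0) (by norm_num) hx)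
    (by simpa using hf.isBigO 0 (by norm_num))
    (by simpa [neg_add, sub_eq_add_neg, add_comm] using hf.isBigO 1 (by norm_num)) h0 hα
  have e2 := mellin_add_one_eq_of_hasDerivAt (β := α + 1) (s := s + 1)
    (hf.continuousOn_iteratedDerivWithin (j := 1) (by norm_num))
    (hf.continuousOn_iteratedDerivWithin (j := 2) (by norm_num))
    (fun x hx => hf.hasDerivAt_iteratedDerivWithin (j := 1) (by norm_num) hx)
    (by simpa [neg_add, sub_eq_add_neg, add_comm] using hf.isBigO 1 (by norm_num))
    (by
      have := hf.isBigO 2 (by norm_num)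
      have e : -(α + 1 + 1) = -α - ((2 : ℕ) : ℝ) := by push_cast; ring
      rwa [e]) (by simp; linarith) (by simp; linarith)
  rw [show s + 2 = s + 1 + 1 by ring, e2, e1, iteratedDerivWithin_zero]
  ring

/-- The transform of `f''` at `s + 2` equals `s(s+1) f*(s)` and is bounded in the strip, so dividing
by `s(s+1)` gains two powers of `|t|`. -/
theorem MuntzClass.exists_norm_mellin_le (hf : MuntzClass α f) {a b : ℝ} (ha : 0 < a) (hab : a ≤ b)
    (hb : b < α) :
    ∃ C : ℝ, 0 ≤ C ∧ ∀ s : ℂ, a ≤ s.re → s.re ≤ b →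
      ‖mellin f s‖ ≤ C * (1 + |s.im|) ^ (-2 : ℝ) := by
  have conv : ∀ σ ∈ Icc a b, MellinConvergent (iteratedDerivWithin 2 f (Ici 0))
      ((σ + 2 : ℝ) : ℂ) := fun σ hσ =>
    mellinConvergent_of_continuousOn (β := α + 2)
      (hf.continuousOn_iteratedDerivWithin le_rfl)
      (by
        have := hf.isBigO 2 le_rfl
        have e : -(α + 2) = -α - ((2 : ℕ) : ℝ) := by push_cast; ring
        rwa [e])
      (by rw [ofReal_re]; linarith [hσ.1]) (by rw [ofReal_re]; linarith [hσ.2])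
  obtain ⟨C, hC0, hC⟩ := Muntz.exists_norm_mellin_le (conv a ⟨le_rfl, hab⟩) (conv b ⟨hab, le_rfl⟩)
  set m : ℝ := min a 1 with hm
  have hm0 : 0 < m := lt_min ha one_pos
  refine ⟨C * (4 / m ^ 2), by positivity, fun s h1 h2 => ?_⟩
  have hM := hC (s + 2) (by simpa using h1) (by simpa using h2)
  rw [hf.mellin_iteratedDerivWithin_two (by linarith) (by linarith), norm_mul, norm_mul] at hM
  -- Applied to `s` and to `s + 1`; the two factors `m/2` account for the constant `4 / m^2`.
  have hlow : ∀ z : ℂ, a ≤ z.re → z.im = s.im → m / 2 * (1 + |s.im|) ≤ ‖z‖ := fun z hz hi => by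
    have n1 := Complex.abs_re_le_norm z
    have n2 := Complex.abs_im_le_norm z
    rw [hi] at n2
    have n3 := le_abs_self z.re
    have h3 := min_le_left a 1
    have h4 := min_le_right a 1
    have h5 := abs_nonneg s.im
    nlinarith
  have l1 := hlow s h1 rfl
  have l2 := hlow (s + 1) (by simp; linarith) (by simp)
  have hp : 0 < 1 + |s.im| := by positivity
  have l3 : (m / 2 * (1 + |s.im|)) * (m / 2 * (1 + |s.im|)) * ‖mellin f s‖ ≤ C :=
    le_trans (mul_le_mul_of_nonneg_right (mul_le_mul l1 l2 (by positivity) (norm_nonneg _))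
      (norm_nonneg _)) hM
  rw [Real.rpow_neg hp.le, show ((2 : ℝ)) = ((2 : ℕ) : ℝ) by norm_num, Real.rpow_natCast,
    ← div_eq_mul_inv, le_div_iff₀ (by positivity)]
  rw [mul_div_assoc', le_div_iff₀ (by positivity)]
  nlinarith

end MuntzClass

end Muntz

namespace Muntz

open Complex

/-! ### A series for `(s - 1) ζ(s)` on `Re s > 0`, with bounds. -/

section ZetaSeries

theorem hasDerivAt_ofReal_cpow {x : ℝ} (hx : 0 < x) (r : ℂ) :
    HasDerivAt (fun y : ℝ => (y : ℂ) ^ r) (r * (x : ℂ) ^ (r - 1)) x := by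
  have := ((hasDerivAt_id (x : ℂ)).cpow_const (c := r)
    (by simpa using ofReal_mem_slitPlane.mpr hx)).comp_ofReal
  simpa using this

theorem norm_cpow_neg_sub_cpow_neg_le {a x : ℝ} (ha : 0 < a) (h1 : a ≤ x) (h2 : x ≤ a + 1) {s : ℂ}
    (hs : 0 ≤ s.re) : ‖(x : ℂ) ^ (-s) - (a : ℂ) ^ (-s)‖ ≤ ‖s‖ * a ^ (-s.re - 1) := by
  have key := Convex.norm_image_sub_le_of_norm_hasDerivWithin_le (𝕜 := ℝ) (s := Icc a (a + 1))
    (f := fun y : ℝ => (y : ℂ) ^ (-s)) (f' := fun y : ℝ => -s * (y : ℂ) ^ (-s - 1))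
    (C := ‖s‖ * a ^ (-s.re - 1)) (x := a) (y := x)
    (fun y hy => (hasDerivAt_ofReal_cpow (ha.trans_le hy.1) _).hasDerivWithinAt)
    (fun y hy => by
      rw [norm_mul, norm_neg, norm_cpow_eq_rpow_re_of_pos (ha.trans_le hy.1)]
      refine mul_le_mul_of_nonneg_left ?_ (norm_nonneg _)
      simpa using Real.rpow_le_rpow_of_nonpos ha hy.1 (by linarith : -s.re - 1 ≤ 0))
    (convex_Icc _ _) ⟨le_rfl, by linarith⟩ ⟨h1, h2⟩
  refine key.trans (mul_le_of_le_one_right (by positivity) ?_)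
  rw [Real.norm_of_nonneg (by linarith)]
  linarith

/-- Interpolates, with weights `1 - θ` and `θ`, between the triangle inequality and the mean value
bound. Taking `θ = 1` gives convergence on `Re s > 0`; a small `θ` costs only `|s|^θ` on the line
`Re s = 1`. -/
theorem norm_cpow_neg_sub_cpow_neg_le_rpow {a x : ℝ} (ha : 0 < a) (h1 : a ≤ x) (h2 : x ≤ a + 1)
    {s : ℂ} (hs : 0 ≤ s.re) {θ : ℝ} (hθ0 : 0 ≤ θ) (hθ1 : θ ≤ 1) :
    ‖(x : ℂ) ^ (-s) - (a : ℂ) ^ (-s)‖ ≤ 2 * (‖s‖ ^ θ * a ^ (-(s.re + θ))) := by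
  set m := ‖(x : ℂ) ^ (-s) - (a : ℂ) ^ (-s)‖ with hm
  have hA : m ≤ 2 * a ^ (-s.re) := by
    refine (norm_sub_le _ _).trans ?_
    rw [norm_cpow_eq_rpow_re_of_pos ha, norm_cpow_eq_rpow_re_of_pos (ha.trans_le h1), neg_re]
    have := Real.rpow_le_rpow_of_nonpos ha h1 (by linarith : -s.re ≤ 0)
    linarith
  have hB : m ≤ ‖s‖ * a ^ (-s.re - 1) := norm_cpow_neg_sub_cpow_neg_le ha h1 h2 hs
  have hm0 : 0 ≤ m := norm_nonneg _
  calc m = m ^ (1 - θ) * m ^ θ := by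
        rw [← Real.rpow_add_of_nonneg hm0 (by linarith) hθ0]
        simp
    _ ≤ (2 * a ^ (-s.re)) ^ (1 - θ) * (‖s‖ * a ^ (-s.re - 1)) ^ θ := by
        gcongr
    _ = 2 ^ (1 - θ) * (‖s‖ ^ θ * a ^ (-(s.re + θ))) := by
        rw [Real.mul_rpow (by norm_num) (by positivity), Real.mul_rpow (by positivity)
          (by positivity), ← Real.rpow_mul ha.le, ← Real.rpow_mul ha.le,
          show -(s.re + θ) = -s.re * (1 - θ) + (-s.re - 1) * θ by ring, Real.rpow_add ha]
        ring
    _ ≤ 2 * (‖s‖ ^ θ * a ^ (-(s.re + θ))) := by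
        refine mul_le_mul_of_nonneg_right ?_ (by positivity)
        calc (2 : ℝ) ^ (1 - θ) ≤ 2 ^ (1 : ℝ) :=
              Real.rpow_le_rpow_of_exponent_le (by norm_num) (by linarith)
          _ = 2 := Real.rpow_one 2

/-- The increments of `zetaPartial`. -/
noncomputable def zetaIncr (n : ℕ) (s : ℂ) : ℂ :=
  (s - 1) * ((n + 1 : ℝ) : ℂ) ^ (-s) + ((n + 2 : ℝ) : ℂ) ^ (1 - s) - ((n + 1 : ℝ) : ℂ) ^ (1 - s)

/-- Entire approximations to `(s - 1) ζ(s)`, converging for `Re s > 0`. -/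
noncomputable def zetaPartial (N : ℕ) (s : ℂ) : ℂ :=
  (s - 1) * ∑ n ∈ Finset.range N, ((n + 1 : ℝ) : ℂ) ^ (-s) + ((N + 1 : ℝ) : ℂ) ^ (1 - s)

theorem zetaPartial_eq (N : ℕ) (s : ℂ) :
    zetaPartial N s = 1 + ∑ n ∈ Finset.range N, zetaIncr n s := by
  induction N with
  | zero => simp [zetaPartial]
  | succ N ih =>
    rw [Finset.sum_range_succ, ← add_assoc, ← ih, zetaPartial, zetaPartial, zetaIncr,
      Finset.sum_range_succ]
    push_cast
    rw [show (N : ℂ) + 1 + 1 = N + 2 by ring]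
    ring

theorem norm_zetaIncr_le (n : ℕ) {s : ℂ} (hs : 0 ≤ s.re) {θ : ℝ} (hθ0 : 0 ≤ θ) (hθ1 : θ ≤ 1) :
    ‖zetaIncr n s‖ ≤ 2 * ‖s - 1‖ * ‖s‖ ^ θ * (n + 1 : ℝ) ^ (-(s.re + θ)) := by
  set a : ℝ := n + 1 with ha'
  have ha : 0 < a := by positivity
  have key := Convex.norm_image_sub_le_of_norm_hasDerivWithin_le (𝕜 := ℝ) (s := Icc a (a + 1))
    -- `zetaIncr n s` is the increment of this function over `[a, a + 1]`, and its derivative is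
    -- `-(s-1)(y^(-s) - a^(-s))`.
    (f := fun y : ℝ => (s - 1) * (a : ℂ) ^ (-s) * y + (y : ℂ) ^ (1 - s))
    (f' := fun y : ℝ => (s - 1) * (a : ℂ) ^ (-s) * 1 + (1 - s) * (y : ℂ) ^ (1 - s - 1))
    (C := 2 * ‖s - 1‖ * ‖s‖ ^ θ * a ^ (-(s.re + θ))) (x := a) (y := a + 1)
    (fun y hy => (((hasDerivAt_id (y : ℂ)).comp_ofReal.const_mul _).add
      (hasDerivAt_ofReal_cpow (ha.trans_le hy.1) _)).hasDerivWithinAt)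
    (fun y hy => by
      have := norm_cpow_neg_sub_cpow_neg_le_rpow ha hy.1 hy.2 hs hθ0 hθ1
      rw [show (s - 1) * (a : ℂ) ^ (-s) * 1 + (1 - s) * (y : ℂ) ^ (1 - s - 1) =
        -((s - 1) * ((y : ℂ) ^ (-s) - (a : ℂ) ^ (-s))) by
          rw [show 1 - s - 1 = -s by ring]
          ring, norm_neg, norm_mul]
      refine (mul_le_mul_of_nonneg_left this (norm_nonneg _)).trans (le_of_eq (by ring)))
    (convex_Icc _ _) ⟨le_rfl, by linarith⟩ ⟨by linarith, le_rfl⟩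
  refine le_trans (le_of_eq ?_) (key.trans (by simp))
  congr 1
  rw [zetaIncr]
  simp only [ha']
  push_cast
  rw [show (n : ℂ) + 1 + 1 = n + 2 by ring]
  ring

theorem differentiable_zetaPartial (N : ℕ) : Differentiable ℂ (zetaPartial N) := by
  have h : ∀ (n : ℕ) (g : ℂ → ℂ), Differentiable ℂ g →
      Differentiable ℂ fun s => ((n + 1 : ℝ) : ℂ) ^ g s := fun n g hg =>
    hg.const_cpow (Or.inl (by exact_mod_cast (by positivity : (n + 1 : ℝ) ≠ 0)))
  unfold zetaPartial
  refine Differentiable.add (Differentiable.mul (by fun_prop) ?_) (h _ _ (by fun_prop))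
  exact Differentiable.fun_sum fun n _ => h n _ (by fun_prop)

theorem summable_natCast_add_one_rpow {r : ℝ} (hr : 1 < r) :
    Summable fun n : ℕ => (n + 1 : ℝ) ^ (-r) := by
  have := (summable_nat_add_iff 1).mpr (Real.summable_nat_rpow.mpr (by linarith : -r < -1))
  simpa using this

theorem isOpen_re_pos : IsOpen {s : ℂ | 0 < s.re} := isOpen_lt continuous_const continuous_re

theorem tendstoLocallyUniformlyOn_zetaPartial_tsum :
    TendstoLocallyUniformlyOn zetaPartial (fun s => 1 + ∑' n, zetaIncr n s) atTop
      {s : ℂ | 0 < s.re} := by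
  refine tendstoLocallyUniformlyOn_of_forall_exists_nhds fun s₀ hs₀ => ?_
  have hs₀' : 0 < s₀.re := hs₀
  set δ := s₀.re / 2 with hδ
  set R := ‖s₀‖ + 1 with hR
  refine ⟨{s | δ < s.re} ∩ Metric.ball 0 R, ?_, ?_⟩
  · refine mem_nhdsWithin_of_mem_nhds (IsOpen.mem_nhds ?_ ⟨?_, ?_⟩)
    · exact (isOpen_lt continuous_const continuous_re).inter Metric.isOpen_ball
    · simp only [mem_ofPred_eq]
      linarith
    · simp [hR]
  · have hu : Summable fun n : ℕ => 2 * (R + 1) * R * (n + 1 : ℝ) ^ (-(δ + 1)) :=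
      (summable_natCast_add_one_rpow (by linarith)).mul_left _
    have hunif := tendstoUniformlyOn_tsum_nat hu (s := {s | δ < s.re} ∩ Metric.ball 0 R)
      (f := zetaIncr) fun n s hs => by
        have h1 : δ < s.re := hs.1
        have h2 : ‖s‖ < R := by simpa using hs.2
        refine (norm_zetaIncr_le n (by linarith : 0 ≤ s.re) zero_le_one le_rfl).trans ?_
        rw [Real.rpow_one]
        have h3 : ‖s - 1‖ ≤ R + 1 := (norm_sub_le _ _).trans (by simp; linarith)
        have h4 : (n + 1 : ℝ) ^ (-(s.re + 1)) ≤ (n + 1 : ℝ) ^ (-(δ + 1)) :=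
          Real.rpow_le_rpow_of_exponent_le (by linarith [Nat.cast_nonneg (α := ℝ) n]) (by linarith)
        gcongr
    rw [Metric.tendstoUniformlyOn_iff] at hunif ⊢
    intro ε hε
    filter_upwards [hunif ε hε] with N hN s hs
    rw [zetaPartial_eq, dist_add_left]
    exact hN s hs

theorem tendsto_zetaPartial_of_one_lt_re {s : ℂ} (hs : 1 < s.re) :
    Tendsto (fun N => zetaPartial N s) atTop (𝓝 (riemannZeta₁ s)) := by
  have hs1 : s ≠ 1 := fun h => by simp [h] at hs
  have h1 : Tendsto (fun N : ℕ => ∑ n ∈ Finset.range N, ((n + 1 : ℝ) : ℂ) ^ (-s)) atTop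
      (𝓝 (riemannZeta s)) := by
    rw [zeta_eq_tsum_one_div_nat_add_one_cpow hs]
    have hsum : Summable fun n : ℕ => 1 / ((n : ℂ) + 1) ^ s := by
      have := (summable_nat_add_iff 1).mpr (Complex.summable_one_div_nat_cpow.mpr hs)
      simpa using this
    refine hsum.hasSum.tendsto_sum_nat.congr fun N => Finset.sum_congr rfl fun n _ => ?_
    rw [cpow_neg]
    push_cast
    rw [one_div]
  have h2 : Tendsto (fun N : ℕ => ((N + 1 : ℝ) : ℂ) ^ (1 - s)) atTop (𝓝 0) := by
    rw [tendsto_zero_iff_norm_tendsto_zero]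
    have : Tendsto (fun x : ℝ => x ^ (-(s.re - 1))) atTop (𝓝 0) :=
      tendsto_rpow_neg_atTop (by linarith)
    refine (this.comp (tendsto_atTop_add_const_right _ 1 tendsto_natCast_atTop_atTop)).congr
      fun N => ?_
    rw [norm_cpow_eq_rpow_re_of_pos (by positivity)]
    simp
  have h3 := (h1.const_mul (s - 1)).add h2
  rw [riemannZeta_eq_inv_sub_mul hs1, add_zero, mul_inv_cancel_left₀ (sub_ne_zero.mpr hs1)] at h3
  exact h3

/-- Both sides are holomorphic on the half-plane and agree for `Re s > 1`, where the correction
`(N+1)^(1-s)` tends to `0`. -/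
theorem riemannZeta₁_eq_tsum {s : ℂ} (hs : 0 < s.re) :
    riemannZeta₁ s = 1 + ∑' n, zetaIncr n s := by
  have hU := isOpen_re_pos
  have hG : DifferentiableOn ℂ (fun s => 1 + ∑' n, zetaIncr n s) {s : ℂ | 0 < s.re} :=
    tendstoLocallyUniformlyOn_zetaPartial_tsum.differentiableOn
      (Eventually.of_forall fun N => (differentiable_zetaPartial N).differentiableOn) hU
  refine AnalyticOnNhd.eqOn_of_preconnected_of_eventuallyEq
    (differentiable_riemannZeta₁.differentiableOn.analyticOnNhd hU) (hG.analyticOnNhd hU)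
    (convex_halfSpace_re_gt 0).isPreconnected (z₀ := 2) (by simp) ?_ hs
  filter_upwards [(isOpen_lt continuous_const continuous_re).mem_nhds
    (show (1 : ℝ) < (2 : ℂ).re by simp)] with z hz
  have hz' : 1 < z.re := hz
  exact tendsto_nhds_unique (tendsto_zetaPartial_of_one_lt_re hz')
    (tendstoLocallyUniformlyOn_zetaPartial_tsum.tendsto_at (show 0 < z.re by linarith))

theorem tendstoLocallyUniformlyOn_zetaPartial :
    TendstoLocallyUniformlyOn zetaPartial riemannZeta₁ atTop {s : ℂ | 0 < s.re} :=
  tendstoLocallyUniformlyOn_zetaPartial_tsum.congr_right fun _ hs => (riemannZeta₁_eq_tsum hs).symm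

theorem exists_norm_riemannZeta₁_le {σ θ : ℝ} (hθ0 : 0 ≤ θ) (hθ1 : θ ≤ 1)
    (hσθ : 1 < σ + θ) :
    ∃ C : ℝ, 0 ≤ C ∧ ∀ s : ℂ, 0 < s.re → σ ≤ s.re →
      ‖riemannZeta₁ s‖ ≤ 1 + C * (‖s - 1‖ * ‖s‖ ^ θ) := by
  have hsum := summable_natCast_add_one_rpow hσθ
  refine ⟨2 * ∑' n : ℕ, (n + 1 : ℝ) ^ (-(σ + θ)), by
    have : 0 ≤ ∑' n : ℕ, (n + 1 : ℝ) ^ (-(σ + θ)) := tsum_nonneg fun n => by positivity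
    positivity, fun s h0 hs => ?_⟩
  rw [riemannZeta₁_eq_tsum h0]
  refine (norm_add_le _ _).trans ?_
  rw [norm_one]
  refine add_le_add_right ?_ 1
  have hle : ∀ n : ℕ, ‖zetaIncr n s‖ ≤
      2 * ‖s - 1‖ * ‖s‖ ^ θ * (n + 1 : ℝ) ^ (-(σ + θ)) := fun n => by
    refine (norm_zetaIncr_le n h0.le hθ0 hθ1).trans ?_
    refine mul_le_mul_of_nonneg_left ?_ (by positivity)
    exact Real.rpow_le_rpow_of_exponent_le (by linarith [Nat.cast_nonneg (α := ℝ) n])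
      (by linarith)
  refine (tsum_of_norm_bounded (hsum.mul_left _).hasSum hle).trans (le_of_eq ?_)
  rw [tsum_mul_left]
  ring

end ZetaSeries

/-! ### Stieltjes constants as Taylor coefficients of `(s - 1) ζ(s)` at `1`. -/

section Stieltjes

theorem tendstoLocallyUniformlyOn_iterate_deriv {U : Set ℂ} (hU : IsOpen U) {F : ℕ → ℂ → ℂ}
    {f : ℂ → ℂ} (h : TendstoLocallyUniformlyOn F f atTop U)
    (hF : ∀ N, DifferentiableOn ℂ (F N) U) (m : ℕ) :
    TendstoLocallyUniformlyOn (fun N => iteratedDeriv m (F N)) (iteratedDeriv m f) atTop U := by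
  induction m generalizing F f with
  | zero => simpa using h
  | succ m ih =>
    simp only [iteratedDeriv_succ']
    exact ih (h.deriv (Eventually.of_forall hF) hU) fun N => (hF N).deriv hU

theorem iteratedDeriv_sub_one_mul_cexp (c : ℂ) (m : ℕ) :
    iteratedDeriv (m + 1) (fun s : ℂ => (s - 1) * cexp (c * s)) =
      fun s => (s - 1) * c ^ (m + 1) * cexp (c * s) + (m + 1) * c ^ m * cexp (c * s) := by
  have he : ∀ s : ℂ, HasDerivAt (fun s : ℂ => cexp (c * s)) (c * cexp (c * s)) s := fun s => by
    simpa [mul_comm] using ((hasDerivAt_id s).const_mul c).cexp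
  induction m with
  | zero =>
    rw [zero_add, iteratedDeriv_one]
    ext s
    rw [(((hasDerivAt_id' s).sub_const 1).fun_mul (he s)).deriv]
    simp
    ring
  | succ m ih =>
    rw [iteratedDeriv_succ, ih]
    ext s
    rw [(((((hasDerivAt_id' s).sub_const 1).mul_const (c ^ (m + 1))).fun_mul (he s)).fun_add
      ((he s).const_mul ((m + 1) * c ^ m))).deriv]
    simp
    ring

theorem iteratedDeriv_zetaPartial_one (N m : ℕ) :
    iteratedDeriv (m + 1) (zetaPartial N) 1 =
      (m + 1) * ∑ n ∈ Finset.range N, (-Complex.log (n + 1 : ℝ)) ^ m / ((n + 1 : ℝ) : ℂ) +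
        (-Complex.log (N + 1 : ℝ)) ^ (m + 1) := by
  have hpos : ∀ n : ℕ, ((n + 1 : ℝ) : ℂ) ≠ 0 := fun n => by
    exact_mod_cast (by positivity : (n + 1 : ℝ) ≠ 0)
  have e1 : zetaPartial N = fun s => (∑ n ∈ Finset.range N,
      (s - 1) * cexp (-Complex.log (n + 1 : ℝ) * s)) +
        ((N + 1 : ℝ) : ℂ) * cexp (-Complex.log (N + 1 : ℝ) * s) := by
    ext s
    rw [zetaPartial, Finset.mul_sum]
    congr 1
    · refine Finset.sum_congr rfl fun n _ => ?_
      rw [cpow_def_of_ne_zero (hpos n)]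
      ring_nf
    · rw [cpow_def_of_ne_zero (hpos N), mul_sub, mul_one, Complex.exp_sub, exp_log (hpos N),
        div_eq_mul_inv, ← Complex.exp_neg]
      ring_nf
  rw [e1, iteratedDeriv_fun_add (by fun_prop) (by fun_prop), iteratedDeriv_fun_sum
    (fun i _ => by fun_prop), Finset.mul_sum]
  congr 1
  · refine Finset.sum_congr rfl fun n _ => ?_
    rw [iteratedDeriv_sub_one_mul_cexp]
    simp only [sub_self, zero_mul, zero_add, mul_one, Complex.exp_neg, exp_log (hpos n)]
    ring
  · rw [iteratedDeriv_const_mul_field, iteratedDeriv_cexp_const_mul]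
    simp only [mul_one, Complex.exp_neg, exp_log (hpos N)]
    rw [mul_left_comm, mul_inv_cancel₀ (hpos N), mul_one]

/-- Locally uniform convergence of `zetaPartial` passes to all derivatives, and those at `s = 1`
are, up to sign and the factor `m + 1`, the expressions defining `γ_m` apart from a vanishing term.
This also proves that the limit exists, so `limUnder` has its intended value. -/
theorem stieltjes_eq (m : ℕ) :
    (stieltjes m : ℂ) = iteratedDeriv (m + 1) riemannZeta₁ 1 / ((m + 1).factorial : ℂ) := by
  set D := iteratedDeriv (m + 1) riemannZeta₁ 1 with hD
  have hlim : Tendsto (fun N => iteratedDeriv (m + 1) (zetaPartial N) 1) atTop (𝓝 D) :=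
    (tendstoLocallyUniformlyOn_iterate_deriv isOpen_re_pos tendstoLocallyUniformlyOn_zetaPartial
      (fun N => (differentiable_zetaPartial N).differentiableOn) (m + 1)).tendsto_at
        (show 0 < (1 : ℂ).re by simp)
  set a : ℕ → ℝ := fun l => ∑ j ∈ Finset.Icc 1 l, Real.log (j : ℝ) ^ m / (j : ℝ) -
        Real.log (l : ℝ) ^ (m + 1) / ((m : ℝ) + 1) with ha
  have hm : (m + 1 : ℂ) ≠ 0 := by exact_mod_cast Nat.succ_ne_zero m
  have hIcc : ∀ (u : ℕ → ℝ) (N : ℕ),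
      ∑ j ∈ Finset.Icc 1 N, u j = ∑ n ∈ Finset.range N, u (n + 1) := fun u N => by
    induction N with
    | zero => simp
    | succ N ih => rw [Finset.sum_Icc_succ_top (by omega), ih, Finset.sum_range_succ]
  have hlog' : ∀ n : ℕ, Complex.log ((n : ℂ) + 1) = ((Real.log (n + 1 : ℝ) : ℝ) : ℂ) := fun n => by
    rw [ofReal_log (by positivity)]
    push_cast
    rfl
  have hneg : ∀ (x : ℝ) (j : ℕ), (-(x : ℂ)) ^ j = (-1) ^ j * (x : ℂ) ^ j := fun x j => neg_pow _ j
  have hsign : ((-1 : ℂ) ^ m) * (-1) ^ m = 1 := by rw [← mul_pow]; simp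
  -- `zetaPartial N` sums up to `N` but its correction involves `log (N + 1)`; the extra last
  -- summand of `a (N + 1)` tends to `0`.
  have hshift : ∀ N : ℕ, ((a (N + 1) : ℝ) : ℂ) =
      (-1) ^ m / (m + 1) * iteratedDeriv (m + 1) (zetaPartial N) 1 +
        ((Real.log (N + 1 : ℝ) ^ m / (N + 1 : ℝ) : ℝ) : ℂ) := fun N => by
    rw [iteratedDeriv_zetaPartial_one, ha]
    simp only
    rw [hIcc, Finset.sum_range_succ]
    push_cast
    simp_rw [hlog', hneg, mul_div_assoc]
    rw [← Finset.mul_sum, pow_succ (-1 : ℂ) m, mul_add]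
    field_simp
    linear_combination (N + 1 : ℂ) * (-(m + 1 : ℂ) * (∑ n ∈ Finset.range N,
      ((Real.log (n + 1 : ℝ) : ℝ) : ℂ) ^ m / (n + 1)) +
        ((Real.log (N + 1 : ℝ) : ℝ) : ℂ) ^ (m + 1)) * hsign
  have hsmall : Tendsto (fun N : ℕ => Real.log (N + 1 : ℝ) ^ m / (N + 1 : ℝ)) atTop (𝓝 0) :=
    (Real.isLittleO_pow_log_id_atTop (n := m)).tendsto_div_nhds_zero.comp
      (tendsto_atTop_add_const_right _ 1 tendsto_natCast_atTop_atTop)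
  have hC : Tendsto (fun l => ((a l : ℝ) : ℂ)) atTop (𝓝 ((-1) ^ m / (m + 1) * D)) := by
    rw [← tendsto_add_atTop_iff_nat 1]
    simp_rw [hshift]
    simpa using (hlim.const_mul _).add ((continuous_ofReal.tendsto 0).comp hsmall)
  have hR : Tendsto a atTop (𝓝 (((-1) ^ m / (m + 1) * D).re)) :=
    (continuous_re.tendsto _).comp hC
  -- A limit of real numbers is real.
  have hval : (((((-1) ^ m / (m + 1) * D).re : ℝ)) : ℂ) = (-1) ^ m / (m + 1) * D :=
    tendsto_nhds_unique ((continuous_ofReal.tendsto _).comp hR) hC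
  rw [stieltjes, hR.limUnder_eq]
  rw [ofReal_mul, hval, Nat.factorial_succ]
  push_cast
  have hf : (m.factorial : ℂ) ≠ 0 := by exact_mod_cast m.factorial_ne_zero
  field_simp
  linear_combination D * hsign

end Stieltjes

end Muntz

namespace Muntz

open Complex

/-! ### The functional equation between `Re s = 0` and `Re s = 1`. -/

section CriticalLines

/-- The reflection formula at `it`, with `Γ(1 - it)` the conjugate of `Γ(1 + it)`: on this line no
Stirling estimate is needed. -/
theorem norm_Gamma_one_add_mul_I_sq (t : ℝ) (ht : t ≠ 0) :
    ‖Gamma (1 + t * I)‖ ^ 2 * Real.sinh (Real.pi * t) = Real.pi * t := by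
  have htI : (t : ℂ) * I ≠ 0 := mul_ne_zero (by exact_mod_cast ht) I_ne_zero
  have hs : Real.sinh (Real.pi * t) ≠ 0 := by
    rw [Ne, Real.sinh_eq_zero]
    exact mul_ne_zero Real.pi_ne_zero ht
  have hs' : Complex.sinh (Real.pi * t) ≠ 0 := by exact_mod_cast hs
  have hconj : Gamma (1 - t * I) = (starRingEnd ℂ) (Gamma (1 + t * I)) := by
    rw [← Gamma_conj]
    simp [sub_eq_add_neg]
  have h1 := Gamma_mul_Gamma_one_sub (t * I)
  rw [← mul_assoc, sin_mul_I] at h1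
  have h2 : Gamma (1 + t * I) = t * I * Gamma (t * I) := by
    rw [add_comm, Gamma_add_one _ htI]
  have h3 : (Gamma (1 + t * I)) * (starRingEnd ℂ) (Gamma (1 + t * I)) *
      Complex.sinh (Real.pi * t) = Real.pi * t := by
    rw [← hconj]
    nth_rewrite 1 [h2]
    rw [mul_assoc (t * I : ℂ), h1]
    have := I_ne_zero
    generalize Complex.sinh (Real.pi * t) = S at hs' ⊢
    field_simp
  rw [mul_conj, normSq_eq_norm_sq] at h3
  exact_mod_cast h3

theorem norm_cos_le_exp_abs_im (z : ℂ) : ‖Complex.cos z‖ ≤ Real.exp |z.im| := by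
  rw [Complex.cos, norm_div]
  have h1 : ‖cexp (z * I)‖ ≤ Real.exp |z.im| := by
    rw [Complex.norm_exp]
    exact Real.exp_le_exp.mpr (by simpa using neg_le_abs z.im)
  have h2 : ‖cexp (-z * I)‖ ≤ Real.exp |z.im| := by
    rw [Complex.norm_exp]
    exact Real.exp_le_exp.mpr (by simpa using le_abs_self z.im)
  have := norm_add_le (cexp (z * I)) (cexp (-z * I))
  rw [Complex.norm_two]
  linarith

theorem norm_Gamma_le {z : ℂ} (hz : 0 < z.re) : ‖Gamma z‖ ≤ Real.Gamma z.re := by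
  rw [Gamma_eq_integral hz, GammaIntegral, Real.Gamma_eq_integral hz]
  refine (MeasureTheory.norm_integral_le_integral_norm _).trans (le_of_eq ?_)
  refine MeasureTheory.setIntegral_congr_fun measurableSet_Ioi fun x hx => ?_
  rw [norm_mul, norm_cpow_eq_rpow_re_of_pos hx, norm_real, Real.norm_of_nonneg (Real.exp_pos _).le]
  simp

/-- In the functional equation the cosine has modulus `|sinh(πt/2)|`, whose growth cancels the decay
of `Γ(1 + it)` and leaves a factor `|t|` after squaring. -/
theorem norm_riemannZeta_neg_mul_I_sq_le (t : ℝ) (ht : t ≠ 0) :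
    ‖riemannZeta (-(t * I))‖ ^ 2 ≤ |t| * ‖riemannZeta (1 + t * I)‖ ^ 2 := by
  have hfe := riemannZeta_one_sub (s := 1 + t * I)
    (fun n h => by
      have := congrArg re h
      simp at this
      linarith [Nat.cast_nonneg (α := ℝ) n])
    (fun h => ht (by simpa using congrArg im h))
  rw [show (1 : ℂ) - (1 + t * I) = -(t * I) by ring] at hfe
  have hcos : ‖Complex.cos (Real.pi * (1 + t * I) / 2)‖ = |Real.sinh (Real.pi * t / 2)| := by
    rw [show (Real.pi * (1 + t * I) / 2 : ℂ) = ((Real.pi * t / 2 : ℝ) : ℂ) * I + Real.pi / 2 by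
      push_cast; ring, cos_add_pi_div_two, sin_mul_I, norm_neg, norm_mul, norm_I, mul_one,
      ← ofReal_sinh, norm_real, Real.norm_eq_abs]
  have hpow : ‖(2 * Real.pi : ℂ) ^ (-(1 + t * I))‖ = (2 * Real.pi)⁻¹ := by
    have : (2 * Real.pi : ℂ) = ((2 * Real.pi : ℝ) : ℂ) := by push_cast; rfl
    rw [this, norm_cpow_eq_rpow_re_of_pos (by positivity)]
    simp [Real.rpow_neg_one]
  have hG := norm_Gamma_one_add_mul_I_sq t ht
  rw [hfe, norm_mul, norm_mul, norm_mul, norm_mul, hcos, hpow, Complex.norm_two, mul_pow, mul_pow,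
    sq_abs]
  refine mul_le_mul_of_nonneg_right ?_ (by positivity)
  set u := ‖Gamma (1 + t * I)‖ with hu
  set y := Real.pi * t / 2 with hy
  rw [show Real.pi * t = 2 * y by rw [hy]; ring, Real.sinh_two_mul] at hG
  have hc := Real.cosh_pos y
  have hcs := Real.cosh_sq y
  have hsc : |Real.sinh y| ≤ Real.cosh y := by
    rw [← abs_of_pos hc]
    exact sq_le_sq.mp (by linarith)
  have hpi := Real.pi_gt_three
  have e1 : u ^ 2 * Real.sinh y ^ 2 * Real.cosh y = y * Real.sinh y := by
    linear_combination (Real.sinh y / 2) * hG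
  have e2 : u ^ 2 * Real.sinh y ^ 2 ≤ |y| := by
    refine le_of_mul_le_mul_right ?_ hc
    rw [e1]
    calc y * Real.sinh y ≤ |y * Real.sinh y| := le_abs_self _
      _ = |y| * |Real.sinh y| := abs_mul _ _
      _ ≤ |y| * Real.cosh y := mul_le_mul_of_nonneg_left hsc (abs_nonneg _)
  have e3 : |y| = Real.pi * |t| / 2 := by
    rw [hy, abs_div, abs_mul, abs_of_pos Real.pi_pos, abs_two]
  rw [e3] at e2
  have hsimp : (2 * (2 * Real.pi)⁻¹ * u) ^ 2 * Real.sinh y ^ 2 =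
      u ^ 2 * Real.sinh y ^ 2 / Real.pi ^ 2 := by
    field_simp
  rw [hsimp, div_le_iff₀ (by positivity)]
  have := abs_nonneg t
  nlinarith [mul_nonneg this Real.pi_pos.le]

end CriticalLines

/-! ### The convexity bound by Phragmén–Lindelöf. -/

section Convexity

/-- The function comparing `ζ` with its convexity bound in the upper half-plane. -/
noncomputable def convexityGauge (a : ℝ) (s : ℂ) : ℂ :=
  (s + 2) ^ (s / 2 - a) * cexp (-(Real.pi / 4) * I * s)

theorem norm_convexityGauge (a : ℝ) {s : ℂ} (hs : 0 ≤ s.re) :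
    ‖convexityGauge a s‖ = ‖s + 2‖ ^ (s.re / 2 - a) *
      Real.exp ((Real.pi / 2 - (s + 2).arg) * s.im / 2) := by
  have hne : s + 2 ≠ 0 := fun h => by
    have := congrArg re h
    simp at this
    linarith
  have h1 : ((s / 2 - a : ℂ)).re = s.re / 2 - a := by simp
  have h2 : ((s / 2 - a : ℂ)).im = s.im / 2 := by simp
  have h3 : (-(Real.pi / 4) * I * s : ℂ).re = Real.pi / 4 * s.im := by
    have : (-(Real.pi / 4) * I * s : ℂ) = ((-(Real.pi / 4) : ℝ) : ℂ) * (I * s) := by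
      push_cast; ring
    rw [this, re_ofReal_mul]
    simp
  rw [convexityGauge, norm_mul, norm_cpow_of_ne_zero hne, Complex.norm_exp, h1, h2, h3, div_eq_mul_inv,
    ← Real.exp_neg, mul_assoc, ← Real.exp_add]
  ring_nf

/-- High in the upper half-plane `π/2 - arg z` is about `Re z / Im z`. Hence the exponential factor
of the gauge stays bounded, and the gauge has size `|s+2|^(Re s/2 - a)` there. -/
theorem pi_div_two_sub_arg_mul_im_le {z : ℂ} (hz : 0 < z.re) :
    (Real.pi / 2 - z.arg) * z.im ≤ Real.pi / 2 * z.re := by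
  have hz0 : z ≠ 0 := fun h => by simp [h] at hz
  have hn : 0 < ‖z‖ := norm_pos_iff.mpr hz0
  have harg := abs_le.mp (abs_arg_le_pi_div_two_iff.mpr hz.le)
  rcases le_total z.im 0 with h | h
  · exact (mul_nonpos_of_nonneg_of_nonpos (by linarith) h).trans (by positivity)
  · have h0 : 0 ≤ z.arg := arg_nonneg_iff.mpr h
    have hsin := Real.mul_le_sin (x := Real.pi / 2 - z.arg) (by linarith) (by linarith)
    rw [Real.sin_pi_div_two_sub, cos_arg hz0] at hsin
    have him := (le_abs_self _).trans (abs_im_le_norm z)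
    have h1 : Real.pi / 2 - z.arg ≤ Real.pi / 2 * (z.re / ‖z‖) := by
      have := mul_le_mul_of_nonneg_left hsin (by positivity : 0 ≤ Real.pi / 2)
      rwa [← mul_assoc, div_mul_div_comm, mul_comm Real.pi 2, div_self (by positivity),
        one_mul] at this
    calc (Real.pi / 2 - z.arg) * z.im ≤ Real.pi / 2 * (z.re / ‖z‖) * ‖z‖ :=
          mul_le_mul h1 him h (by positivity)
      _ = Real.pi / 2 * z.re := by field_simp

theorem norm_convexityGauge_le (a : ℝ) {s : ℂ} (h0 : 0 ≤ s.re) (h1 : s.re ≤ 1) :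
    ‖convexityGauge a s‖ ≤ ‖s + 2‖ ^ (s.re / 2 - a) * Real.exp Real.pi := by
  rw [norm_convexityGauge a h0]
  refine mul_le_mul_of_nonneg_left (Real.exp_le_exp.mpr ?_) (by positivity)
  have := pi_div_two_sub_arg_mul_im_le (z := s + 2) (by simp; linarith)
  simp only [add_im, im_ofNat, add_zero, add_re, re_ofNat] at this
  nlinarith [Real.pi_pos]

/-- The lower bound needs `Im s ≥ 0`: in the lower half-plane the gauge decays exponentially. That
half is recovered later by conjugation. -/
theorem le_norm_convexityGauge (a : ℝ) {s : ℂ} (h0 : 0 ≤ s.re) (h1 : 0 ≤ s.im) :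
    ‖s + 2‖ ^ (s.re / 2 - a) ≤ ‖convexityGauge a s‖ := by
  rw [norm_convexityGauge a h0]
  refine le_mul_of_one_le_right (by positivity) (Real.one_le_exp ?_)
  have harg := abs_le.mp (abs_arg_le_pi_div_two_iff.mpr
    (show 0 ≤ (s + 2).re by simp; linarith))
  have : 0 ≤ Real.pi / 2 - (s + 2).arg := by linarith
  positivity

theorem differentiableAt_convexityGauge (a : ℝ) {s : ℂ} (hs : -2 < s.re) :
    DifferentiableAt ℂ (convexityGauge a) s := by
  unfold convexityGauge
  refine DifferentiableAt.mul (DifferentiableAt.cpow (by fun_prop) (by fun_prop) (Or.inl ?_))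
    (by fun_prop)
  simp
  linarith

/-- The crude growth hypothesis required by Phragmén–Lindelöf. The series handles `Re s ≥ 1/2` and
the functional equation the rest; the exponent is `5 = 1 + 2 + 2`, from `s - 1`, the cosine and the
reflected value. -/
theorem exists_norm_riemannZeta₁_le_exp :
    ∃ C : ℝ, ∀ s : ℂ, 0 < s.re → s.re < 1 → 1 ≤ |s.im| →
      ‖riemannZeta₁ s‖ ≤ C * Real.exp (5 * |s.im|) := by
  obtain ⟨C, hC0, hC⟩ := exists_norm_riemannZeta₁_le (σ := 1 / 2) (θ := 1) (by norm_num) le_rfl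
    (by norm_num)
  obtain ⟨M, hM⟩ := (isCompact_Icc (a := (1 / 2 : ℝ)) (b := 1)).exists_bound_of_continuousOn
    (f := Real.Gamma) fun x hx => (Real.differentiableAt_Gamma fun m h => by
      have := hx.1
      have := Nat.cast_nonneg (α := ℝ) m
      linarith).continuousAt.continuousWithinAt
  have hM0 : 0 ≤ M := (norm_nonneg _).trans (hM 1 ⟨by norm_num, le_rfl⟩)
  have hlin : ∀ y : ℝ, 0 ≤ y → 1 + y ≤ Real.exp y := fun y _ => by
    linarith [Real.add_one_le_exp y]
  have hnorm : ∀ z : ℂ, 0 ≤ z.re → z.re ≤ 1 → ‖z‖ ≤ Real.exp |z.im| := fun z h0 h1 => by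
    have := norm_le_abs_re_add_abs_im z
    rw [abs_of_nonneg h0] at this
    exact le_trans (by linarith) (hlin _ (abs_nonneg _))
  have hright : ∀ z : ℂ, 1 / 2 ≤ z.re → z.re ≤ 1 →
      ‖riemannZeta₁ z‖ ≤ (1 + C) * Real.exp (2 * |z.im|) := fun z h0 h1 => by
    have b1 := hnorm z (by linarith) h1
    have b2 : ‖z - 1‖ ≤ Real.exp |z.im| := by
      have := hnorm (1 - z) (by simpa using h1) (by simp; linarith)
      rw [norm_sub_rev]
      simpa using this
    have b3 := hC z (by linarith) h0
    rw [Real.rpow_one] at b3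
    have e : Real.exp (2 * |z.im|) = Real.exp |z.im| * Real.exp |z.im| := by
      rw [← Real.exp_add]; ring_nf
    have b4 : 1 ≤ Real.exp (2 * |z.im|) := Real.one_le_exp (by positivity)
    have b5 : ‖z - 1‖ * ‖z‖ ≤ Real.exp (2 * |z.im|) := by
      rw [e]
      exact mul_le_mul b2 b1 (norm_nonneg _) (Real.exp_pos _).le
    nlinarith
  refine ⟨(1 + C) + 2 * M * (1 + C), fun s h0 h1 ht => ?_⟩
  have hee : Real.exp (2 * |s.im|) ≤ Real.exp (5 * |s.im|) :=
    Real.exp_le_exp.mpr (by linarith [abs_nonneg s.im])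
  rcases le_total (1 / 2) s.re with h | h
  · refine (hright s h h1.le).trans ?_
    calc (1 + C) * Real.exp (2 * |s.im|) ≤ (1 + C) * Real.exp (5 * |s.im|) := by gcongr
      _ ≤ _ := mul_le_mul_of_nonneg_right (by nlinarith) (Real.exp_pos _).le
  · have him : s.im ≠ 0 := fun e => by simp [e] at ht; linarith
    set w := 1 - s with hw
    have hwre : w.re = 1 - s.re := by simp [hw]
    have hwim : |w.im| = |s.im| := by simp [hw]
    have hs1 : s ≠ 1 := fun e => him (by simp [e])
    have hw1 : w ≠ 1 := fun e => him (by
      have := congrArg im e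
      simpa [hw] using this)
    have hfe := riemannZeta_one_sub (s := w)
      (fun n h => by
        have := congrArg re h
        simp only [hwre, neg_re, natCast_re] at this
        linarith [Nat.cast_nonneg (α := ℝ) n]) hw1
    rw [show 1 - w = s by rw [hw]; ring, riemannZeta_eq_inv_sub_mul hs1,
      riemannZeta_eq_inv_sub_mul hw1] at hfe
    have hs1' : s - 1 ≠ 0 := sub_ne_zero.mpr hs1
    have hZ : riemannZeta₁ s = (s - 1) * (2 * (2 * Real.pi) ^ (-w) * Gamma w *
        Complex.cos (Real.pi * w / 2) * ((w - 1)⁻¹ * riemannZeta₁ w)) := by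
      rw [← hfe, mul_inv_cancel_left₀ hs1']
    have n1 : ‖s - 1‖ ≤ Real.exp |s.im| := by
      have := hnorm w (by linarith) (by linarith)
      rw [norm_sub_rev]
      rwa [hwim] at this
    have n2 : ‖(2 * Real.pi : ℂ) ^ (-w)‖ ≤ 1 := by
      have : (2 * Real.pi : ℂ) = ((2 * Real.pi : ℝ) : ℂ) := by push_cast; rfl
      rw [this, norm_cpow_eq_rpow_re_of_pos (by positivity)]
      refine Real.rpow_le_one_of_one_le_of_nonpos (by linarith [Real.pi_gt_three]) ?_
      simp only [neg_re]
      linarith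
    have n3 : ‖Gamma w‖ ≤ M := by
      refine (norm_Gamma_le (by linarith)).trans ((le_abs_self _).trans (hM w.re ⟨?_, ?_⟩)) <;>
        linarith
    have n4 : ‖Complex.cos (Real.pi * w / 2)‖ ≤ Real.exp (2 * |s.im|) := by
      refine (norm_cos_le_exp_abs_im _).trans (Real.exp_le_exp.mpr ?_)
      have : (Real.pi * w / 2 : ℂ).im = Real.pi / 2 * w.im := by
        rw [show (Real.pi * w / 2 : ℂ) = ((Real.pi / 2 : ℝ) : ℂ) * w by push_cast; ring, im_ofReal_mul]
      rw [this, abs_mul, hwim, abs_of_pos (by positivity)]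
      exact mul_le_mul_of_nonneg_right (by linarith [Real.pi_lt_four]) (abs_nonneg _)
    have n5 : ‖(w - 1)⁻¹‖ ≤ 1 := by
      rw [norm_inv]
      refine inv_le_one_of_one_le₀ ?_
      have := abs_im_le_norm (w - 1)
      simp only [sub_im, one_im, sub_zero, hwim] at this
      linarith
    have n6 : ‖riemannZeta₁ w‖ ≤ (1 + C) * Real.exp (2 * |s.im|) := by
      have := hright w (by linarith) (by linarith)
      rwa [hwim] at this
    rw [hZ]
    simp only [norm_mul, Complex.norm_two]
    calc ‖s - 1‖ * (2 * ‖(2 * Real.pi : ℂ) ^ (-w)‖ * ‖Gamma w‖ *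
          ‖Complex.cos (Real.pi * w / 2)‖ * (‖(w - 1)⁻¹‖ * ‖riemannZeta₁ w‖))
        ≤ Real.exp |s.im| * (2 * 1 * M * Real.exp (2 * |s.im|) *
          (1 * ((1 + C) * Real.exp (2 * |s.im|)))) := by gcongr
      _ = 2 * M * (1 + C) * (Real.exp |s.im| * Real.exp (2 * |s.im|) * Real.exp (2 * |s.im|)) := by
          ring
      _ = 2 * M * (1 + C) * Real.exp (5 * |s.im|) := by
          rw [← Real.exp_add, ← Real.exp_add]
          ring_nf
      _ ≤ _ := mul_le_mul_of_nonneg_right (by linarith) (Real.exp_pos _).le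

theorem one_le_norm_add_two {s : ℂ} (hs : 0 ≤ s.re) : 1 ≤ ‖s + 2‖ := by
  have := (le_abs_self _).trans (abs_re_le_norm (s + 2))
  simp only [add_re, re_ofNat] at this
  linarith

theorem norm_le_norm_of_sq_le {z w : ℂ} (h : z.re ^ 2 + z.im ^ 2 ≤ w.re ^ 2 + w.im ^ 2) :
    ‖z‖ ≤ ‖w‖ := by
  rw [norm_eq_sqrt_sq_add_sq, norm_eq_sqrt_sq_add_sq]
  exact Real.sqrt_le_sqrt h

theorem exists_norm_riemannZeta₁_le_of_one_le_re {ε : ℝ} (hε0 : 0 < ε) (hε1 : ε ≤ 1) :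
    ∃ C : ℝ, 0 ≤ C ∧ ∀ s : ℂ, 1 ≤ s.re → ‖riemannZeta₁ s‖ ≤ C * ‖s + 2‖ ^ (1 + ε) := by
  obtain ⟨C, hC0, hC⟩ := exists_norm_riemannZeta₁_le (σ := 1) hε0.le hε1 (by linarith)
  refine ⟨1 + C, by linarith, fun s hs => (hC s (by linarith) hs).trans ?_⟩
  have h0 := one_le_norm_add_two (s := s) (by linarith)
  have h1 : ‖s - 1‖ ≤ ‖s + 2‖ := norm_le_norm_of_sq_le (by simp; nlinarith)
  have h2 : ‖s‖ ≤ ‖s + 2‖ := norm_le_norm_of_sq_le (by simp; nlinarith)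
  have h3 : ‖s - 1‖ * ‖s‖ ^ ε ≤ ‖s + 2‖ ^ (1 + ε) := by
    rw [Real.rpow_add (by linarith), Real.rpow_one]
    gcongr
  have h4 : 1 ≤ ‖s + 2‖ ^ (1 + ε) := Real.one_le_rpow h0 (by linarith)
  nlinarith

/-- The exponent is `1 - 1/2 + (1 + ε)`: from `s - 1`, from `|t|^(1/2) |t|^(-1)`, and from the bound
on `Re s = 1`. Compactness covers `|Im s| ≤ 1`. -/
theorem exists_norm_riemannZeta₁_le_of_re_eq_zero {ε : ℝ} (hε0 : 0 < ε) (hε1 : ε ≤ 1) :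
    ∃ C : ℝ, 0 ≤ C ∧ ∀ s : ℂ, s.re = 0 → ‖riemannZeta₁ s‖ ≤ C * ‖s + 2‖ ^ (3 / 2 + ε) := by
  obtain ⟨C, hC0, hC⟩ := exists_norm_riemannZeta₁_le_of_one_le_re hε0 hε1
  obtain ⟨M, hM⟩ := (isCompact_closedBall (0 : ℂ) 1).exists_bound_of_continuousOn
    (f := riemannZeta₁) differentiable_riemannZeta₁.continuous.continuousOn
  have hM0 : 0 ≤ M := (norm_nonneg _).trans (hM 0 (by simp))
  refine ⟨M + C * (2 ^ (1 + ε) * 3 ^ (1 / 2 : ℝ)), by positivity, fun s hs => ?_⟩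
  have h0 := one_le_norm_add_two (s := s) (by linarith)
  have hs_eq : s = ((s.im : ℝ) : ℂ) * I := by
    apply Complex.ext <;> simp [hs]
  have hp : 0 < ‖s + 2‖ := by linarith
  rcases le_total |s.im| 1 with h | h
  · have hb : ‖riemannZeta₁ s‖ ≤ M := hM s (by
      rw [mem_closedBall_zero_iff, hs_eq, norm_mul, norm_I, mul_one, norm_real]
      exact h)
    have h4 : 1 ≤ ‖s + 2‖ ^ (3 / 2 + ε) := Real.one_le_rpow h0 (by linarith)
    have h5 : 0 ≤ C * (2 ^ (1 + ε) * 3 ^ (1 / 2 : ℝ)) := by positivity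
    nlinarith
  · set t := -s.im with ht
    have htabs : |t| = |s.im| := abs_neg _
    have ht1 : 1 ≤ |t| := by rwa [htabs]
    have htp : 0 < |t| := by linarith
    have ht0 : t ≠ 0 := abs_pos.mp htp
    have hst : s = -(t * I) := by
      rw [ht, ofReal_neg, neg_mul, neg_neg]
      exact hs_eq
    have hrefl := norm_riemannZeta_neg_mul_I_sq_le t ht0
    rw [← hst] at hrefl
    have hs1 : s ≠ 1 := fun e => by simp [e] at hs
    have hw1 : (1 : ℂ) + t * I ≠ 1 := fun e => ht0 (by simpa using congrArg im e)
    have hw : ‖riemannZeta (1 + t * I)‖ ≤ |t|⁻¹ * (C * (2 * ‖s + 2‖) ^ (1 + ε)) := by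
      rw [riemannZeta_eq_inv_sub_mul hw1, norm_mul]
      have e1 : ‖((1 : ℂ) + t * I - 1)⁻¹‖ = |t|⁻¹ := by
        rw [add_sub_cancel_left, norm_inv, norm_mul, norm_I, mul_one, norm_real, Real.norm_eq_abs]
      have e2 : ‖(1 : ℂ) + t * I + 2‖ ≤ 2 * ‖s + 2‖ := by
        rw [show 2 * ‖s + 2‖ = ‖2 * (s + 2)‖ by rw [norm_mul, Complex.norm_two]]
        refine norm_le_norm_of_sq_le ?_
        simp [hs, ht]
        nlinarith [sq_nonneg s.im]
      rw [e1]
      refine mul_le_mul_of_nonneg_left ((hC _ (by simp)).trans ?_) (by positivity)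
      gcongr
    have hzeta : ‖riemannZeta s‖ ≤ |t| ^ (1 / 2 : ℝ) * (|t|⁻¹ * (C * (2 * ‖s + 2‖) ^ (1 + ε))) := by
      refine le_of_sq_le_sq ?_ (by positivity)
      rw [mul_pow]
      have e3 : (|t| ^ (1 / 2 : ℝ)) ^ 2 = |t| := by
        rw [← Real.sqrt_eq_rpow, Real.sq_sqrt htp.le]
      rw [e3]
      refine hrefl.trans (mul_le_mul_of_nonneg_left ?_ htp.le)
      gcongr
    have hinv : |t| ^ (1 / 2 : ℝ) * |t|⁻¹ ≤ 3 ^ (1 / 2 : ℝ) * ‖s + 2‖ ^ (-(1 / 2) : ℝ) := by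
      have e4 : |t| ^ (1 / 2 : ℝ) * |t|⁻¹ = |t| ^ (-(1 / 2) : ℝ) := by
        rw [← Real.rpow_neg_one, ← Real.rpow_add htp]
        norm_num
      have e5 : ‖s + 2‖ / 3 ≤ |t| := by
        have := norm_le_abs_re_add_abs_im (s + 2)
        simp only [add_re, hs, re_ofNat, zero_add, add_im, im_ofNat, add_zero, abs_two] at this
        rw [htabs] at *
        linarith
      rw [e4]
      refine (Real.rpow_le_rpow_of_nonpos (by positivity) e5 (by norm_num)).trans (le_of_eq ?_)
      rw [Real.div_rpow hp.le (by norm_num), Real.rpow_neg (by norm_num : (0 : ℝ) ≤ 3), div_inv_eq_mul,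
        mul_comm]
    have hs1n : ‖s - 1‖ ≤ ‖s + 2‖ := norm_le_norm_of_sq_le (by simp [hs])
    have hZ : riemannZeta₁ s = (s - 1) * riemannZeta s := by
      rw [riemannZeta_eq_inv_sub_mul hs1, mul_inv_cancel_left₀ (sub_ne_zero.mpr hs1)]
    rw [hZ, norm_mul]
    calc ‖s - 1‖ * ‖riemannZeta s‖
        ≤ ‖s + 2‖ * (|t| ^ (1 / 2 : ℝ) * (|t|⁻¹ * (C * (2 * ‖s + 2‖) ^ (1 + ε)))) := by gcongr
      _ = ‖s + 2‖ * (|t| ^ (1 / 2 : ℝ) * |t|⁻¹) * (C * (2 * ‖s + 2‖) ^ (1 + ε)) := by ring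
      _ ≤ ‖s + 2‖ * (3 ^ (1 / 2 : ℝ) * ‖s + 2‖ ^ (-(1 / 2) : ℝ)) *
          (C * (2 * ‖s + 2‖) ^ (1 + ε)) := by gcongr
      _ = C * (2 ^ (1 + ε) * 3 ^ (1 / 2 : ℝ)) * ‖s + 2‖ ^ (3 / 2 + ε) := by
          rw [show (3 / 2 + ε : ℝ) = 1 + -(1 / 2) + (1 + ε) by ring, Real.rpow_add hp,
            Real.rpow_add hp, Real.rpow_one, Real.mul_rpow (by norm_num) hp.le]
          ring
      _ ≤ _ := mul_le_mul_of_nonneg_right (by linarith) (by positivity)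

/-- The exponent `3/2 + ε - Re s/2` interpolates linearly between the two edges. Multiplying by the
gauge makes both edge bounds constant, Phragmén–Lindelöf fills the strip, and the gauge is divided
out where it is bounded below. -/
theorem exists_norm_riemannZeta₁_le_of_im_nonneg {ε : ℝ} (hε0 : 0 < ε) (hε1 : ε ≤ 1) :
    ∃ C : ℝ, 0 ≤ C ∧ ∀ s : ℂ, 0 ≤ s.re → s.re ≤ 1 → 0 ≤ s.im →
      ‖riemannZeta₁ s‖ ≤ C * ‖s + 2‖ ^ (3 / 2 + ε - s.re / 2) := by
  obtain ⟨C₀, hC₀, h₀⟩ := exists_norm_riemannZeta₁_le_of_re_eq_zero hε0 hε1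
  obtain ⟨C₁, hC₁, h₁⟩ := exists_norm_riemannZeta₁_le_of_one_le_re hε0 hε1
  obtain ⟨K, hK⟩ := exists_norm_riemannZeta₁_le_exp
  set a : ℝ := 3 / 2 + ε with ha
  set C := (C₀ + C₁) * Real.exp Real.pi with hC
  have hbd : ∀ s : ℂ, 0 ≤ s.re → s.re ≤ 1 →
      ‖riemannZeta₁ s‖ ≤ (C₀ + C₁) * ‖s + 2‖ ^ (a - s.re / 2) →
      ‖riemannZeta₁ s * convexityGauge a s‖ ≤ C := fun s h0 h1 hz => by
    have hp : 0 < ‖s + 2‖ := by linarith [one_le_norm_add_two h0]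
    rw [norm_mul]
    refine (mul_le_mul hz (norm_convexityGauge_le a h0 h1) (norm_nonneg _)
      (by positivity)).trans (le_of_eq ?_)
    have : ‖s + 2‖ ^ (a - s.re / 2) * ‖s + 2‖ ^ (s.re / 2 - a) = 1 := by
      rw [← Real.rpow_add hp]
      simp
    linear_combination (C₀ + C₁) * Real.exp Real.pi * this
  have hPL : ∀ s : ℂ, 0 ≤ s.re → s.re ≤ 1 → ‖riemannZeta₁ s * convexityGauge a s‖ ≤ C :=
    fun s h0 h1 => by
    refine PhragmenLindelof.vertical_strip (a := 0) (b := 1)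
      (f := fun s => riemannZeta₁ s * convexityGauge a s) ?_ ?_ ?_ ?_ h0 h1
    · refine DifferentiableOn.diffContOnCl fun z hz => ?_
      have hz' : (0 : ℝ) ≤ z.re := by
        have : closure (re ⁻¹' Ioo (0 : ℝ) 1) ⊆ re ⁻¹' Ici 0 :=
          closure_minimal (fun w hw => hw.1.le) (isClosed_Ici.preimage continuous_re)
        exact this hz
      exact (differentiable_riemannZeta₁.differentiableAt.mul
        (differentiableAt_convexityGauge a (by linarith))).differentiableWithinAt
    -- Growth `exp(5 exp |Im z|)` is allowed in a strip of width `1` because `1 < π`.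
    · refine ⟨1, by simpa using (by linarith [Real.pi_gt_three] : 1 < Real.pi), 5, ?_⟩
      refine IsBigO.of_bound (K * Real.exp Real.pi) ?_
      have hev : ∀ᶠ z : ℂ in comap (_root_.abs ∘ im) atTop ⊓ 𝓟 (re ⁻¹' Ioo 0 1),
          1 ≤ |z.im| ∧ z ∈ re ⁻¹' Ioo (0 : ℝ) 1 :=
        ((tendsto_comap.eventually (eventually_ge_atTop (1 : ℝ))).filter_mono inf_le_left).and
          (mem_inf_of_right (mem_principal_self _))
      filter_upwards [hev] with z hz
      obtain ⟨hz1, hz2, hz3⟩ := hz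
      have hz2' : 0 < z.re := hz2
      have hz3' : z.re < 1 := hz3
      have b1 := hK z hz2' hz3' hz1
      have b2 : ‖convexityGauge a z‖ ≤ Real.exp Real.pi := by
        refine (norm_convexityGauge_le a hz2'.le hz3'.le).trans ?_
        refine mul_le_of_le_one_left (Real.exp_pos _).le ?_
        exact Real.rpow_le_one_of_one_le_of_nonpos (one_le_norm_add_two hz2'.le) (by linarith)
      have hK0 : 0 ≤ K := by
        by_contra hneg
        have := (norm_nonneg _).trans b1
        nlinarith [Real.exp_pos (5 * |z.im|)]
      rw [norm_mul, Real.norm_of_nonneg (Real.exp_pos _).le, one_mul]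
      have b3 : Real.exp (5 * |z.im|) ≤ Real.exp (5 * Real.exp |z.im|) :=
        Real.exp_le_exp.mpr (by linarith [Real.add_one_le_exp |z.im|])
      calc ‖riemannZeta₁ z‖ * ‖convexityGauge a z‖
          ≤ K * Real.exp (5 * |z.im|) * Real.exp Real.pi := by gcongr
        _ ≤ K * Real.exp (5 * Real.exp |z.im|) * Real.exp Real.pi := by gcongr
        _ = _ := by ring
    · intro z hz
      refine hbd z hz.ge (by linarith) ((h₀ z hz).trans ?_)
      rw [hz, zero_div, sub_zero]
      exact mul_le_mul_of_nonneg_right (by linarith) (by positivity)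
    · intro z hz
      refine hbd z (by linarith) hz.le ((h₁ z hz.ge).trans ?_)
      rw [hz, show a - 1 / 2 = 1 + ε by rw [ha]; ring]
      exact mul_le_mul_of_nonneg_right (by linarith) (by positivity)
  refine ⟨C, by positivity, fun s h0 h1 him => ?_⟩
  have hp : 0 < ‖s + 2‖ := by linarith [one_le_norm_add_two h0]
  have hk := hPL s h0 h1
  rw [norm_mul] at hk
  have hk' := (mul_le_mul_of_nonneg_left (le_norm_convexityGauge a h0 him)
    (norm_nonneg (riemannZeta₁ s))).trans hk
  rw [show s.re / 2 - a = -(a - s.re / 2) by ring, Real.rpow_neg hp.le, ← div_eq_mul_inv,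
    div_le_iff₀ (by positivity)] at hk'
  exact hk'

theorem exists_norm_riemannZeta₁_le_convexity {ε : ℝ} (hε0 : 0 < ε) (hε1 : ε ≤ 1) :
    ∃ C : ℝ, 0 ≤ C ∧ ∀ s : ℂ, 0 ≤ s.re → s.re ≤ 1 →
      ‖riemannZeta₁ s‖ ≤ C * ‖s + 2‖ ^ (3 / 2 + ε - s.re / 2) := by
  obtain ⟨C, hC0, hC⟩ := exists_norm_riemannZeta₁_le_of_im_nonneg hε0 hε1
  refine ⟨C, hC0, fun s h0 h1 => ?_⟩
  rcases le_total 0 s.im with h | h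
  · exact hC s h0 h1 h
  · have hconj : ‖riemannZeta₁ ((starRingEnd ℂ) s)‖ = ‖riemannZeta₁ s‖ := by
      rcases eq_or_ne s 1 with rfl | hs
      · simp
      · have hs' : (starRingEnd ℂ) s ≠ 1 := fun e => hs (by
          have := congrArg (starRingEnd ℂ) e
          simpa using this)
        have e : ∀ z : ℂ, z ≠ 1 → riemannZeta₁ z = (z - 1) * riemannZeta z := fun z hz => by
          rw [riemannZeta_eq_inv_sub_mul hz, mul_inv_cancel_left₀ (sub_ne_zero.mpr hz)]
        rw [e _ hs, e _ hs', riemannZeta_conj, ← map_one (starRingEnd ℂ), ← map_sub, ← map_mul,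
          norm_conj, map_one]
    have := hC ((starRingEnd ℂ) s) (by simpa) (by simpa) (by simpa using h)
    rw [hconj, conj_re] at this
    have e2 : ‖(starRingEnd ℂ) s + 2‖ = ‖s + 2‖ := by
      rw [← norm_conj (s + 2), map_add, map_ofNat]
    rwa [e2] at this

/-- The convexity bound for `ζ`, uniformly in vertical strips and away from the real axis. -/
theorem exists_norm_riemannZeta_le {σ b ε : ℝ} (hσ0 : 0 < σ) (hσ1 : σ ≤ 1) (hε0 : 0 < ε)
    (hε1 : ε ≤ 1) :
    ∃ C : ℝ, 0 ≤ C ∧ ∀ s : ℂ, σ ≤ s.re → s.re ≤ b → 1 ≤ |s.im| →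
      ‖riemannZeta s‖ ≤ C * (1 + |s.im|) ^ ((1 - σ) / 2 + ε) := by
  obtain ⟨C₀, hC₀, h₀⟩ := exists_norm_riemannZeta₁_le_convexity hε0 hε1
  obtain ⟨C₁, hC₁, h₁⟩ := exists_norm_riemannZeta₁_le_of_one_le_re hε0 hε1
  set B : ℝ := |b| + 3 with hB
  have hB1 : 1 ≤ B := by linarith [abs_nonneg b]
  refine ⟨2 * ((C₀ + C₁) * B ^ (1 + ((1 - σ) / 2 + ε))), by positivity, fun s hs hsb ht => ?_⟩
  set T : ℝ := 1 + |s.im| with hT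
  have hT0 : 0 < T := by positivity
  have hT1 : 1 ≤ T := by linarith [abs_nonneg s.im]
  have h2 := one_le_norm_add_two (s := s) (by linarith)
  have hnorm : ‖s + 2‖ ≤ B * T := by
    have h3 := norm_le_abs_re_add_abs_im (s + 2)
    simp only [add_re, re_ofNat, add_im, im_ofNat, add_zero] at h3
    rw [abs_of_nonneg (by linarith)] at h3
    have := le_abs_self b
    have := abs_nonneg b
    nlinarith
  have hs1 : s ≠ 1 := fun e => by simp [e] at ht; linarith
  -- The leading `1` in the exponent is what division by `s - 1` removes.
  have hZ : ‖riemannZeta₁ s‖ ≤ (C₀ + C₁) * ‖s + 2‖ ^ (1 + ((1 - σ) / 2 + ε)) := by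
    rcases le_total s.re 1 with h | h
    · refine (h₀ s (by linarith) h).trans (mul_le_mul (by linarith) ?_ (by positivity)
        (by positivity))
      exact Real.rpow_le_rpow_of_exponent_le h2 (by linarith)
    · refine (h₁ s h).trans (mul_le_mul (by linarith) ?_ (by positivity) (by positivity))
      exact Real.rpow_le_rpow_of_exponent_le h2 (by linarith)
  have hsub : T / 2 ≤ ‖s - 1‖ := by
    have := abs_im_le_norm (s - 1)
    simp only [sub_im, one_im, sub_zero] at this
    linarith
  rw [riemannZeta_eq_inv_sub_mul hs1, norm_mul, norm_inv]
  calc ‖s - 1‖⁻¹ * ‖riemannZeta₁ s‖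
      ≤ (T / 2)⁻¹ * ((C₀ + C₁) * (B * T) ^ (1 + ((1 - σ) / 2 + ε))) := by
        gcongr
        exact hZ.trans (by gcongr)
    _ = 2 * ((C₀ + C₁) * B ^ (1 + ((1 - σ) / 2 + ε))) * T ^ ((1 - σ) / 2 + ε) := by
        rw [Real.mul_rpow (by linarith) hT0.le, Real.rpow_add hT0, Real.rpow_one]
        field_simp

end Convexity

end Muntz

namespace Muntz

open Complex MeasureTheory

/-! ### The Dirichlet series of `d_k`. -/

section DivisorFun

theorem divisorFun_zero (n : ℕ) : divisorFun 0 n = if n = 1 then 1 else 0 := by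
  unfold divisorFun
  split_ifs with h
  · rw [h, Nat.finMulAntidiag_one, Finset.card_singleton]
  · rw [Nat.finMulAntidiag_zero_left h, Finset.card_empty]

/-- Splitting off the first factor exhibits `d_{k+1}` as the Dirichlet convolution of `1` and `d_k`.
-/
theorem divisorFun_succ (k n : ℕ) :
    divisorFun (k + 1) n = ∑ d ∈ n.divisorsAntidiagonal, divisorFun k d.2 := by
  unfold divisorFun
  rw [← Finset.card_sigma]
  refine Finset.card_nbij' (fun b => ⟨(b 0, ∏ i : Fin k, b i.succ), fun i => b i.succ⟩)
    (fun c => Fin.cons c.1.1 c.2) ?_ ?_ ?_ ?_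
  · intro b hb
    simp only [Finset.mem_coe, Nat.mem_finMulAntidiag, Fin.prod_univ_succ] at hb
    simp only [Finset.mem_coe, Finset.mem_sigma, Nat.mem_divisorsAntidiagonal,
      Nat.mem_finMulAntidiag, true_and]
    exact ⟨hb, right_ne_zero_of_mul (hb.1.symm ▸ hb.2)⟩
  · rintro ⟨⟨d, e⟩, c⟩ hc
    simp only [Finset.mem_coe, Finset.mem_sigma, Nat.mem_divisorsAntidiagonal,
      Nat.mem_finMulAntidiag] at hc
    simp only [Finset.mem_coe, Nat.mem_finMulAntidiag, Fin.prod_univ_succ, Fin.cons_zero,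
      Fin.cons_succ]
    rw [hc.2.1]
    exact hc.1
  · intro b _
    exact Fin.cons_self_tail b
  · rintro ⟨⟨d, e⟩, c⟩ hc
    simp only [Finset.mem_coe, Finset.mem_sigma, Nat.mem_divisorsAntidiagonal,
      Nat.mem_finMulAntidiag] at hc
    simp only [Fin.cons_zero, Fin.cons_succ, hc.2.1]

theorem LSeriesHasSum_divisorFun (k : ℕ) {s : ℂ} (hs : 1 < s.re) :
    LSeriesHasSum (fun n => (divisorFun k n : ℂ)) s (riemannZeta s ^ k) := by
  induction k with
  | zero =>
    rw [pow_zero]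
    have e : LSeries.term (fun n => (divisorFun 0 n : ℂ)) s = fun n => if n = 1 then 1 else 0 := by
      ext n
      rw [← LSeries.term_delta s n]
      refine LSeries.term_congr (fun {m} _ => ?_) s n
      rw [divisorFun_zero, LSeries.delta]
      split_ifs <;> simp
    rw [LSeriesHasSum, e]
    exact hasSum_ite_eq 1 1
  | succ k ih =>
    rw [pow_succ']
    refine (LSeriesHasSum_congr s _ fun {n} _ => ?_).mp ((LSeriesHasSum_one hs).convolution ih)
    rw [LSeries.convolution_def, divisorFun_succ]
    simp

theorem hasSum_divisorFun (k : ℕ) {s : ℂ} (hs : 1 < s.re) :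
    HasSum (fun n : ℕ+ => (divisorFun k n : ℂ) * (((n : ℕ) : ℝ) : ℂ) ^ (-s))
      (riemannZeta s ^ k) := by
  have h := (PNat.coe_injective.hasSum_iff (f := LSeries.term (fun n => (divisorFun k n : ℂ)) s)
    (fun n hn => by
      have : n = 0 := by
        by_contra h0
        exact hn ⟨⟨n, Nat.pos_of_ne_zero h0⟩, rfl⟩
      rw [this, LSeries.term_zero])).mpr (LSeriesHasSum_divisorFun k hs)
  convert h using 2 with n
  rw [Function.comp_apply, LSeries.term_of_ne_zero n.ne_zero, cpow_neg, div_eq_mul_inv,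
    ofReal_natCast]

end DivisorFun

/-! ### Mellin integrals of powers of the logarithm. -/

section LogIntegrals

/-- `log t ^ j` cut off to `(0, 1]`. -/
noncomputable def logPowIoc (j : ℕ) : ℝ → ℂ :=
  indicator (Ioc 0 1) fun t => ((Real.log t : ℝ) : ℂ) ^ j

theorem log_smul_logPowIoc (j : ℕ) :
    (fun t : ℝ => Real.log t • logPowIoc j t) = logPowIoc (j + 1) := by
  ext t
  by_cases ht : t ∈ Ioc (0 : ℝ) 1
  · simp [logPowIoc, ht, pow_succ']
  · simp [logPowIoc, ht]

theorem logPowIoc_isBigO (j : ℕ) {b : ℝ} (hb : 0 < b) :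
    logPowIoc j =O[𝓝[>] 0] fun t : ℝ => t ^ (-b) := by
  induction j generalizing b with
  | zero =>
    refine IsBigO.of_bound 1 ?_
    filter_upwards [Ioo_mem_nhdsGT (zero_lt_one' ℝ)] with t ht
    have : t ∈ Ioc (0 : ℝ) 1 := ⟨ht.1, ht.2.le⟩
    simp only [logPowIoc, indicator_of_mem this, pow_zero, norm_one, one_mul]
    rw [Real.norm_of_nonneg (Real.rpow_nonneg ht.1.le _)]
    exact Real.one_le_rpow_of_pos_of_le_one_of_nonpos ht.1 ht.2.le (by linarith)
  | succ j ih =>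
    rw [← log_smul_logPowIoc]
    exact isBigO_rpow_zero_log_smul (by linarith : b / 2 < b) (ih (by linarith))

theorem logPowIoc_locallyIntegrableOn (j : ℕ) : LocallyIntegrableOn (logPowIoc j) (Ioi 0) := by
  have hc : ContinuousOn (fun t : ℝ => ((Real.log t : ℝ) : ℂ) ^ j) (Ioi 0) :=
    (continuous_ofReal.comp_continuousOn
      (Real.continuousOn_log.mono fun t ht => ne_of_gt ht)).pow j
  refine (hc.locallyIntegrableOn measurableSet_Ioi).mono ?_
    (Eventually.of_forall fun t => norm_indicator_le_norm_self _ t)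
  refine (Measurable.indicator ?_ measurableSet_Ioc).aestronglyMeasurable
  exact (measurable_ofReal.comp Real.measurable_log).pow_const j

/-- Differentiating the transform in `s` multiplies the function by `log t`, so the formula follows
from `1/s` by induction. -/
theorem hasMellin_logPowIoc (j : ℕ) {s : ℂ} (hs : 0 < s.re) :
    HasMellin (logPowIoc j) s ((-1) ^ j * (j.factorial : ℂ) / s ^ (j + 1)) := by
  induction j generalizing s with
  | zero =>
    have := hasMellin_one_Ioc hs
    simpa [logPowIoc] using! this
  | succ j ih =>
    have htop : logPowIoc j =O[atTop] fun t : ℝ => t ^ (-(s.re + 1)) := by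
      refine IsBigO.of_bound 0 ?_
      filter_upwards [eventually_gt_atTop 1] with t ht
      have : t ∉ Ioc (0 : ℝ) 1 := fun h => by linarith [h.2]
      simp [logPowIoc, this]
    obtain ⟨hconv, hderiv⟩ := mellin_hasDerivAt_of_isBigO_rpow (logPowIoc_locallyIntegrableOn j)
      htop (by linarith) (logPowIoc_isBigO j (half_pos hs)) (by linarith)
    rw [log_smul_logPowIoc] at hconv hderiv
    refine ⟨hconv, ?_⟩
    have hs0 : s ≠ 0 := fun h => by simp [h] at hs
    have h2 : HasDerivAt (mellin (logPowIoc j))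
        ((-1) ^ j * (j.factorial : ℂ) * (-((j + 1 : ℕ) * s ^ j) / (s ^ (j + 1)) ^ 2)) s := by
      have h3 := ((hasDerivAt_pow (j + 1) s).fun_inv (pow_ne_zero _ hs0)).const_mul
        ((-1) ^ j * (j.factorial : ℂ))
      simp only [Nat.add_sub_cancel] at h3
      refine h3.congr_of_eventuallyEq ?_
      filter_upwards [isOpen_re_pos.mem_nhds hs] with z hz
      rw [(ih hz).2, div_eq_mul_inv]
    rw [hderiv.unique h2, Nat.factorial_succ]
    push_cast
    field_simp
    ring

theorem integral_Ioc_log_pow_mul_cpow (j : ℕ) {s : ℂ} (hs : s.re < 1) :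
    IntegrableOn (fun y : ℝ => ((Real.log y : ℝ) : ℂ) ^ j * (y : ℂ) ^ (-s)) (Ioc 0 1) ∧
      ∫ y in Ioc (0 : ℝ) 1, ((Real.log y : ℝ) : ℂ) ^ j * (y : ℂ) ^ (-s) =
        -((j.factorial : ℂ) / (s - 1) ^ (j + 1)) := by
  obtain ⟨h1, h2⟩ := hasMellin_logPowIoc j (s := 1 - s) (by simpa using hs)
  have e : (fun t : ℝ => (t : ℂ) ^ (1 - s - 1) • logPowIoc j t) =
      indicator (Ioc 0 1) fun y : ℝ => ((Real.log y : ℝ) : ℂ) ^ j * (y : ℂ) ^ (-s) := by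
    ext t
    by_cases ht : t ∈ Ioc (0 : ℝ) 1
    · simp only [logPowIoc, indicator_of_mem ht, smul_eq_mul]
      rw [show 1 - s - 1 = -s by ring, mul_comm]
    · simp [logPowIoc, ht]
  have hinter : Ioi (0 : ℝ) ∩ Ioc 0 1 = Ioc 0 1 := inter_eq_right.mpr fun x hx => hx.1
  rw [MellinConvergent, e, IntegrableOn, integrable_indicator_iff measurableSet_Ioc, IntegrableOn,
    Measure.restrict_restrict measurableSet_Ioc, inter_comm, hinter] at h1
  rw [mellin, e, setIntegral_indicator measurableSet_Ioc, hinter] at h2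
  refine ⟨h1, h2.trans ?_⟩
  rw [show (1 - s) ^ (j + 1) = (-1) ^ (j + 1) * (s - 1) ^ (j + 1) by rw [← mul_pow]; ring_nf,
    pow_succ (-1 : ℂ) j]
  have : ((-1 : ℂ) ^ j) ≠ 0 := pow_ne_zero _ (by norm_num)
  rw [mul_assoc ((-1 : ℂ) ^ j), mul_div_mul_left _ _ this, neg_one_mul, div_neg]

/-- Obtained from the integral over `(0, 1]` by `y ↦ 1/y`. The two integrals are opposite as
rational functions, although their half-planes of convergence are disjoint. -/
theorem integral_Ioi_log_pow_mul_cpow (j : ℕ) {s : ℂ} (hs : 1 < s.re) :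
    IntegrableOn (fun y : ℝ => ((Real.log y : ℝ) : ℂ) ^ j * (y : ℂ) ^ (-s)) (Ioi 1) ∧
      ∫ y in Ioi (1 : ℝ), ((Real.log y : ℝ) : ℂ) ^ j * (y : ℂ) ^ (-s) =
        (j.factorial : ℂ) / (s - 1) ^ (j + 1) := by
  obtain ⟨h1, h2⟩ := hasMellin_logPowIoc j (s := s - 1) (by simpa using hs)
  have hconv : MellinConvergent (fun t : ℝ => logPowIoc j t⁻¹) (1 - s) := by
    have := MellinConvergent.comp_rpow (f := logPowIoc j) (s := 1 - s) (a := -1) (by norm_num)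
    simp only [Real.rpow_neg_one] at this
    rw [this]
    simpa [div_neg] using h1
  have hval : mellin (fun t : ℝ => logPowIoc j t⁻¹) (1 - s) =
      (-1) ^ j * (j.factorial : ℂ) / (s - 1) ^ (j + 1) := by
    rw [mellin_comp_inv, neg_sub, h2]
  have e : ∀ t ∈ Ioi (0 : ℝ), (t : ℂ) ^ (1 - s - 1) • logPowIoc j t⁻¹ =
      indicator (Ici 1) (fun y : ℝ => (-1) ^ j *
        (((Real.log y : ℝ) : ℂ) ^ j * (y : ℂ) ^ (-s))) t := fun t ht => by
    have ht0 : (0 : ℝ) < t := ht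
    by_cases h : t ∈ Ici (1 : ℝ)
    · have h' : t⁻¹ ∈ Ioc (0 : ℝ) 1 := ⟨by positivity, inv_le_one_of_one_le₀ h⟩
      simp only [logPowIoc, indicator_of_mem h, indicator_of_mem h', smul_eq_mul, Real.log_inv]
      rw [show 1 - s - 1 = -s by ring, ofReal_neg, neg_pow]
      ring
    · have h' : t⁻¹ ∉ Ioc (0 : ℝ) 1 := fun hh => h (by
        have := (inv_le_one₀ ht0).mp hh.2
        exact this)
      simp [logPowIoc, h, h']
  have hinter : Ioi (0 : ℝ) ∩ Ici 1 = Ici 1 := inter_eq_right.mpr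
    fun x (hx : 1 ≤ x) => show (0 : ℝ) < x from lt_of_lt_of_le one_pos hx
  have hpm : ((-1 : ℂ) ^ j) * (-1) ^ j = 1 := by rw [← mul_pow]; simp
  rw [MellinConvergent, integrableOn_congr_fun e measurableSet_Ioi, IntegrableOn,
    integrable_indicator_iff measurableSet_Ici, IntegrableOn,
    Measure.restrict_restrict measurableSet_Ici, inter_comm, hinter] at hconv
  rw [mellin, setIntegral_congr_fun measurableSet_Ioi e, setIntegral_indicator measurableSet_Ici,
    hinter, integral_const_mul, integral_Ici_eq_integral_Ioi] at hval
  constructor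
  · have := (IntegrableOn.mono_set hconv Ioi_subset_Ici_self).const_mul ((-1) ^ j)
    refine this.congr (Eventually.of_forall fun y => ?_)
    simp only
    rw [← mul_assoc, hpm, one_mul]
  · linear_combination (-1) ^ j * hval + ((j.factorial : ℂ) / (s - 1) ^ (j + 1) -
      ∫ y in Ioi (1 : ℝ), ((Real.log y : ℝ) : ℂ) ^ j * (y : ℂ) ^ (-s)) * hpm

end LogIntegrals

/-! ### Laurent coefficients of `ζ^k` at `1` and the constants `c_{k,r}`. -/

section LaurentCoefficients

/-- Iterating the divided difference at `c` keeps the function entire and peels off one Taylor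
coefficient each time. -/
theorem exists_taylor_remainder {f : ℂ → ℂ} (hf : Differentiable ℂ f) (c : ℂ) (n : ℕ) :
    ∃ R : ℂ → ℂ, Differentiable ℂ R ∧ ∀ s, f s =
      ∑ i ∈ Finset.range n, iteratedDeriv i f c / (i.factorial : ℂ) * (s - c) ^ i +
        (s - c) ^ n * R s := by
  set D : ℕ → ℂ → ℂ := fun n => (Function.swap dslope c)^[n] f with hD
  have hsucc : ∀ n, D (n + 1) = dslope (D n) c := fun n => by
    simp only [hD, Function.iterate_succ_apply']
  have hdiff : ∀ n, Differentiable ℂ (D n) := fun n => by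
    induction n with
    | zero => exact hf
    | succ n ih =>
      rw [hsucc, ← differentiableOn_univ, differentiableOn_dslope univ_mem]
      exact ih.differentiableOn
  have hval : ∀ n, D n c = iteratedDeriv n f c / (n.factorial : ℂ) := fun n => by
    have h := (hf.analyticAt c).hasFPowerSeriesAt.has_fpower_series_iterate_dslope_fslope n
    have h0 := h.coeff_zero 1
    have h1 := FormalMultilinearSeries.coeff_iterate_fslope
      (p := FormalMultilinearSeries.ofScalars ℂ fun n => iteratedDeriv n f c / (n.factorial : ℂ)) n 0
    rw [zero_add, FormalMultilinearSeries.coeff_ofScalars] at h1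
    rw [← h1]
    exact h0.symm
  refine ⟨D n, hdiff n, fun s => ?_⟩
  induction n with
  | zero => simp [hD]
  | succ n ih =>
    rw [ih, Finset.sum_range_succ, ← hval, add_assoc, hsucc]
    congr 1
    have := sub_smul_dslope (D n) c s
    rw [smul_eq_mul] at this
    rw [pow_succ, mul_assoc, this]
    ring

/-- The first terms of the Taylor expansion of `(s - 1) ζ(s)` at `s = 1`. -/
noncomputable def zetaPoly (k : ℕ) : Polynomial ℝ :=
  1 + ∑ i ∈ Finset.range k, Polynomial.C (stieltjes i) * Polynomial.X ^ (i + 1)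

theorem exists_riemannZeta₁_eq (k : ℕ) :
    ∃ R : ℂ → ℂ, Differentiable ℂ R ∧ ∀ s, riemannZeta₁ s =
      ((zetaPoly k).map ofRealHom).eval (s - 1) + (s - 1) ^ (k + 1) * R s := by
  obtain ⟨R, hR, h⟩ := exists_taylor_remainder differentiable_riemannZeta₁ 1 (k + 1)
  refine ⟨R, hR, fun s => ?_⟩
  rw [h s, Finset.sum_range_succ']
  congr 1
  simp only [← stieltjes_eq, zetaPoly, iteratedDeriv_zero, riemannZeta₁_one, Nat.factorial_zero,
    Nat.cast_one, div_one, pow_zero, mul_one, Polynomial.map_add, Polynomial.map_one,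
    Polynomial.eval_add, Polynomial.eval_one]
  rw [add_comm]
  simp [Polynomial.eval_finsetSum, Polynomial.map_sum]

theorem exists_riemannZeta₁_pow_eq (k : ℕ) :
    ∃ H : ℂ → ℂ, Differentiable ℂ H ∧ ∀ s, riemannZeta₁ s ^ k =
      ∑ r ∈ Finset.range k, (((zetaPoly k ^ k).coeff r : ℝ) : ℂ) * (s - 1) ^ r +
        (s - 1) ^ k * H s := by
  obtain ⟨R, hR, h⟩ := exists_riemannZeta₁_eq k
  set p := (zetaPoly k).map ofRealHom with hp
  have hdvd : Polynomial.X ^ k ∣ p ^ k - ∑ r ∈ Finset.range k,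
      Polynomial.C ((p ^ k).coeff r) * Polynomial.X ^ r := by
    rw [Polynomial.X_pow_dvd_iff]
    intro d hd
    rw [Polynomial.coeff_sub, Polynomial.finsetSum_coeff]
    simp only [Polynomial.coeff_C_mul_X_pow]
    rw [Finset.sum_ite_eq, if_pos (Finset.mem_range.mpr hd), sub_self]
  obtain ⟨q, hq⟩ := hdvd
  -- `q` collects the terms of `p ^ k` of degree at least `k`; the rest comes from factoring
  -- `riemannZeta₁ s ^ k - p ^ k`, which contains `(s - 1) ^ (k + 1)`.
  refine ⟨fun s => q.eval (s - 1) + (s - 1) * R s *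
    ∑ i ∈ Finset.range k, riemannZeta₁ s ^ i * p.eval (s - 1) ^ (k - 1 - i), ?_, fun s => ?_⟩
  · have hpoly : ∀ u : Polynomial ℂ, Differentiable ℂ fun s : ℂ => u.eval (s - 1) := fun u =>
      u.differentiable.comp (differentiable_id.sub_const 1)
    refine (hpoly q).add (Differentiable.mul (Differentiable.mul (by fun_prop) hR) ?_)
    exact Differentiable.fun_sum fun i _ =>
      (differentiable_riemannZeta₁.pow i).mul ((hpoly p).pow _)
  · have h1 := geom_sum₂_mul (riemannZeta₁ s) (p.eval (s - 1)) k
    have h2 := congrArg (Polynomial.eval (s - 1)) hq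
    have h3 : riemannZeta₁ s - p.eval (s - 1) = (s - 1) ^ (k + 1) * R s := by rw [h s]; ring
    rw [h3] at h1
    simp only [Polynomial.eval_sub, Polynomial.eval_pow, Polynomial.eval_finsetSum,
      Polynomial.eval_mul, Polynomial.eval_C, Polynomial.eval_X] at h2
    have h4 : ∀ r, (p ^ k).coeff r = (((zetaPoly k ^ k).coeff r : ℝ) : ℂ) := fun r => by
      rw [hp, ← Polynomial.map_pow, Polynomial.coeff_map]
      rfl
    simp only [h4] at h2
    linear_combination h2 - h1

/-- Binomial then multinomial expansion, grouping tuples by `n = ∑ b_i`; the two coefficients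
multiply to `k! / ((k-n)! ∏ b_i!)`. -/
theorem coeff_one_add_sum_pow (r k : ℕ) (hr : r ≤ k) (g : Fin r → ℝ) :
    ((1 + ∑ i : Fin r, Polynomial.C (g i) * Polynomial.X ^ ((i : ℕ) + 1)) ^ k).coeff r =
      (k.factorial : ℝ) * ∑ b ∈ weightedTuples r, (∏ i : Fin r, g i ^ b i) /
        (((k - ∑ i, b i).factorial : ℝ) * ∏ i : Fin r, ((b i).factorial : ℝ)) := by
  have hmon : ∀ b : Fin r → ℕ, ∏ i : Fin r, (Polynomial.C (g i) * Polynomial.X ^ ((i : ℕ) + 1)) ^ b i =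
      Polynomial.C (∏ i : Fin r, g i ^ b i) *
        Polynomial.X ^ (∑ i : Fin r, ((i : ℕ) + 1) * b i) := fun b => by
    simp only [mul_pow, Finset.prod_mul_distrib, ← Polynomial.C_pow, ← map_prod, ← pow_mul,
      Finset.prod_pow_eq_pow_sum]
  have hle : ∀ b ∈ weightedTuples r, ∑ i, b i ∈ Finset.range (k + 1) := fun b hb => by
    rw [mem_weightedTuples] at hb
    rw [Finset.mem_range, Nat.lt_succ_iff]
    refine le_trans ?_ (hb.le.trans hr)
    exact Finset.sum_le_sum fun i _ => Nat.le_mul_of_pos_left _ (Nat.succ_pos _)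
  rw [add_comm, add_pow, Polynomial.finsetSum_coeff, Finset.mul_sum,
    ← Finset.sum_fiberwise_of_maps_to hle]
  refine Finset.sum_congr rfl fun n hn => ?_
  have hnk : n ≤ k := Nat.lt_succ_iff.mp (Finset.mem_range.mp hn)
  rw [one_pow, mul_one, Finset.sum_pow_eq_sum_piAntidiag, mul_comm, ← Polynomial.C_eq_natCast,
    Polynomial.coeff_C_mul, Polynomial.finsetSum_coeff, Finset.mul_sum]
  simp only [hmon, ← Polynomial.C_eq_natCast, Polynomial.coeff_C_mul, Polynomial.coeff_X_pow]
  rw [show (weightedTuples r).filter (fun b => ∑ i, b i = n) =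
      (Finset.univ.piAntidiag n).filter
        (fun b : Fin r → ℕ => r = ∑ i : Fin r, ((i : ℕ) + 1) * b i) by
    ext b
    simp only [Finset.mem_filter, mem_weightedTuples, Finset.mem_piAntidiag, Finset.mem_univ,
      implies_true, and_true]
    tauto, Finset.sum_filter]
  refine Finset.sum_congr rfl fun b hb => ?_
  have hbn : ∑ i, b i = n := (Finset.mem_piAntidiag.mp hb).1
  split_ifs with h
  · rw [hbn]
    have h1 : (k.choose n : ℝ) * n.factorial * (k - n).factorial = k.factorial := by
      exact_mod_cast Nat.choose_mul_factorial_mul_factorial hnk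
    have h2 : (∏ i : Fin r, ((b i).factorial : ℝ)) * (Nat.multinomial Finset.univ b : ℝ) =
        n.factorial := by
      rw [← hbn]
      exact_mod_cast Nat.multinomial_spec Finset.univ b
    have h3 : ((k - n).factorial : ℝ) ≠ 0 := by exact_mod_cast Nat.factorial_ne_zero _
    have h4 : (∏ i : Fin r, ((b i).factorial : ℝ)) ≠ 0 :=
      Finset.prod_ne_zero_iff.mpr fun i _ => by exact_mod_cast Nat.factorial_ne_zero _
    rw [mul_div_assoc', eq_div_iff (mul_ne_zero h3 h4), mul_one, ← h1, ← h2]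
    ring
  · simp

theorem coeff_zetaPoly_pow {k r : ℕ} (hr : r < k) :
    (zetaPoly k ^ k).coeff r = ((k - 1 - r).factorial : ℝ) * coeffC k r := by
  set p : Polynomial ℝ := 1 + ∑ i : Fin r, Polynomial.C (stieltjes i) * Polynomial.X ^ ((i : ℕ) + 1)
    with hp
  -- Terms `γ_i X^(i+1)` with `i ≥ r` cannot affect the coefficient of `X^r`.
  have hdvd : Polynomial.X ^ (r + 1) ∣ zetaPoly k - p := by
    have : zetaPoly k - p = ∑ i ∈ Finset.Ico r k,
        Polynomial.C (stieltjes i) * Polynomial.X ^ (i + 1) := by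
      rw [Finset.sum_Ico_eq_sub _ hr.le, hp, zetaPoly,
        ← Fin.sum_univ_eq_sum_range (fun i => Polynomial.C (stieltjes i) * Polynomial.X ^ (i + 1)) r]
      ring
    rw [this]
    refine Finset.dvd_sum fun i hi => Dvd.dvd.mul_left (pow_dvd_pow _ ?_) _
    have := (Finset.mem_Ico.mp hi).1
    omega
  have h0 := Polynomial.X_pow_dvd_iff.mp (hdvd.trans (sub_dvd_pow_sub_pow _ _ k)) r (Nat.lt_succ_self r)
  rw [Polynomial.coeff_sub, sub_eq_zero] at h0
  rw [h0, hp, coeff_one_add_sum_pow r k hr.le, coeffC, ← mul_assoc, mul_div_cancel₀]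
  exact_mod_cast Nat.factorial_ne_zero _

theorem polyP_eq {k : ℕ} (hk : 1 ≤ k) :
    polyP k = ∑ r ∈ Finset.range k, Polynomial.C (coeffC k r) * Polynomial.X ^ (k - 1 - r) := by
  have h0 : coeffC k 0 = 1 / ((k - 1).factorial : ℝ) := by
    have hc := coeff_zetaPoly_pow (k := k) (r := 0) hk
    have h1 : (zetaPoly k ^ k).coeff 0 = 1 := by
      rw [Polynomial.coeff_zero_eq_eval_zero, Polynomial.eval_pow, zetaPoly]
      simp [Polynomial.eval_finsetSum]
    rw [h1, Nat.sub_zero] at hc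
    rw [eq_div_iff (by exact_mod_cast Nat.factorial_ne_zero _), hc]
    ring
  obtain ⟨m, rfl⟩ : ∃ m, k = m + 1 := ⟨k - 1, by omega⟩
  rw [polyP, Finset.sum_range_succ', h0, add_comm]
  congr 1
  simp only [Nat.add_sub_cancel]
  rw [Finset.range_eq_Ico, Finset.sum_Ico_add' (fun i => Polynomial.C (coeffC (m + 1) i) *
    Polynomial.X ^ (m - i)) 0 m 1]
  rfl

end LaurentCoefficients

end Muntz

namespace Muntz

open Complex MeasureTheory

/-! ### The polynomial `P_{k-1}` and the polar part of `ζ^k`. -/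

section PolarPart

/-- The polar part of `ζ(s) ^ k` at `s = 1`. -/
noncomputable def polarPart (k : ℕ) (s : ℂ) : ℂ :=
  ∑ r ∈ Finset.range k, (((zetaPoly k ^ k).coeff r : ℝ) : ℂ) / (s - 1) ^ (k - r)

theorem exists_riemannZeta_pow_eq (k : ℕ) :
    ∃ H : ℂ → ℂ, Differentiable ℂ H ∧
      ∀ s, s ≠ 1 → riemannZeta s ^ k = polarPart k s + H s := by
  obtain ⟨H, hH, h⟩ := exists_riemannZeta₁_pow_eq k
  refine ⟨H, hH, fun s hs => ?_⟩
  have hs0 : s - 1 ≠ 0 := sub_ne_zero.mpr hs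
  rw [riemannZeta_eq_inv_sub_mul hs, mul_pow, h s, mul_add, inv_pow,
    inv_mul_cancel_left₀ (pow_ne_zero _ hs0), polarPart, Finset.mul_sum]
  congr 1
  refine Finset.sum_congr rfl fun r hr => ?_
  have hrk : r + (k - r) = k := Nat.add_sub_cancel' (Finset.mem_range.mp hr).le
  have : (s - 1) ^ k = (s - 1) ^ r * (s - 1) ^ (k - r) := by rw [← pow_add, hrk]
  rw [this]
  have h1 := pow_ne_zero r hs0
  have h2 := pow_ne_zero (k - r) hs0
  field_simp

theorem norm_polarPart_le (k : ℕ) {s : ℂ} (hs : 1 ≤ |s.im|) :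
    ‖polarPart k s‖ ≤ ∑ r ∈ Finset.range k, |(zetaPoly k ^ k).coeff r| := by
  have h1 : 1 ≤ ‖s - 1‖ := hs.trans (by simpa using abs_im_le_norm (s - 1))
  refine (norm_sum_le _ _).trans (Finset.sum_le_sum fun r _ => ?_)
  rw [norm_div, norm_real, Real.norm_eq_abs, norm_pow]
  exact div_le_self (abs_nonneg _) (one_le_pow₀ h1)

theorem eval_polyP {k : ℕ} (hk : 1 ≤ k) (u : ℝ) :
    (((polyP k).eval u : ℝ) : ℂ) =
      ∑ r ∈ Finset.range k, (coeffC k r : ℂ) * (u : ℂ) ^ (k - 1 - r) := by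
  rw [polyP_eq hk]
  simp [Polynomial.eval_finsetSum]

/-- Treats `(0, 1]` with `e = -1` and `(1, ∞)` with `e = 1` together; the `j!` of the integral
supplies the `(k-1-r)!` relating `coeffC` to the Laurent coefficient. -/
theorem integral_polyP_mul_cpow {k : ℕ} (hk : 1 ≤ k) {S : Set ℝ} {s e : ℂ}
    (h : ∀ j : ℕ, IntegrableOn (fun y : ℝ => ((Real.log y : ℝ) : ℂ) ^ j * (y : ℂ) ^ (-s)) S ∧
      ∫ y in S, ((Real.log y : ℝ) : ℂ) ^ j * (y : ℂ) ^ (-s) =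
        e * ((j.factorial : ℂ) / (s - 1) ^ (j + 1))) :
    IntegrableOn (fun y : ℝ => (((polyP k).eval (Real.log y) : ℝ) : ℂ) * (y : ℂ) ^ (-s)) S ∧
      ∫ y in S, (((polyP k).eval (Real.log y) : ℝ) : ℂ) * (y : ℂ) ^ (-s) =
        e * polarPart k s := by
  simp only [eval_polyP hk, Finset.sum_mul, mul_assoc]
  refine ⟨integrable_finsetSum _ fun r _ => (h _).1.const_mul _, ?_⟩
  rw [integral_finsetSum _ fun r _ => (h _).1.const_mul _, polarPart, Finset.mul_sum]
  refine Finset.sum_congr rfl fun r hr => ?_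
  have hr' := Finset.mem_range.mp hr
  rw [integral_const_mul, (h _).2, coeff_zetaPoly_pow hr', show k - 1 - r + 1 = k - r by omega]
  push_cast
  ring

theorem integral_Ioc_polyP_mul_cpow {k : ℕ} (hk : 1 ≤ k) {s : ℂ} (hs : s.re < 1) :
    IntegrableOn (fun y : ℝ => (((polyP k).eval (Real.log y) : ℝ) : ℂ) * (y : ℂ) ^ (-s))
      (Ioc 0 1) ∧
      ∫ y in Ioc (0 : ℝ) 1, (((polyP k).eval (Real.log y) : ℝ) : ℂ) * (y : ℂ) ^ (-s) =
        -1 * polarPart k s :=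
  integral_polyP_mul_cpow hk fun j => by
    rw [neg_one_mul]
    exact integral_Ioc_log_pow_mul_cpow j hs

theorem integral_Ioi_polyP_mul_cpow {k : ℕ} (hk : 1 ≤ k) {s : ℂ} (hs : 1 < s.re) :
    IntegrableOn (fun y : ℝ => (((polyP k).eval (Real.log y) : ℝ) : ℂ) * (y : ℂ) ^ (-s))
      (Ioi 1) ∧
      ∫ y in Ioi (1 : ℝ), (((polyP k).eval (Real.log y) : ℝ) : ℂ) * (y : ℂ) ^ (-s) =
        1 * polarPart k s :=
  integral_polyP_mul_cpow hk fun j => by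
    rw [one_mul]
    exact integral_Ioi_log_pow_mul_cpow j hs

end PolarPart

/-! ### Assembly: inverse Mellin representation and final inversion. -/

section Muntz

variable {α : ℝ} {f : ℝ → ℂ}

theorem MuntzClass.exists_norm_mellin_mul_le (hf : MuntzClass α f) {k : ℕ} (hk : 1 ≤ k)
    {H : ℂ → ℂ} (hH : Differentiable ℂ H)
    (hζ : ∀ s, s ≠ 1 → riemannZeta s ^ k = polarPart k s + H s) {σ c : ℝ} (h0 : 0 < σ)
    (h1 : 1 - 2 / (k : ℝ) < σ) (hσ1 : σ ≤ 1) (hσc : σ ≤ c) (hc : c < α) :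
    ∃ C r : ℝ, 1 < r ∧ ∀ s : ℂ, σ ≤ s.re → s.re ≤ c →
      ‖mellin f s * H s‖ ≤ C * (1 + |s.im|) ^ (-r) := by
  have hk0 : (0 : ℝ) < k := by exact_mod_cast hk
  obtain ⟨ε, hε0, hε1, hε⟩ : ∃ ε : ℝ, 0 < ε ∧ ε ≤ 1 ∧ ((1 - σ) / 2 + ε) * k < 1 := by
    have hδ : 0 < 1 / (k : ℝ) - (1 - σ) / 2 := by
      have : 2 / (k : ℝ) = 2 * (1 / k) := by ring
      linarith
    -- Half of the gap left by `σ > 1 - 2/k`, capped so that the convexity bound applies.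
    refine ⟨min 1 ((1 / (k : ℝ) - (1 - σ) / 2) / 2), lt_min one_pos (by linarith),
      min_le_left _ _, ?_⟩
    rw [← lt_div_iff₀ hk0]
    have := min_le_right 1 ((1 / (k : ℝ) - (1 - σ) / 2) / 2)
    linarith
  set θ := (1 - σ) / 2 + ε with hθ
  have hθ0 : 0 ≤ θ * k := by
    have : 0 ≤ θ := by linarith
    positivity
  obtain ⟨C₁, hC₁, hb₁⟩ := exists_norm_riemannZeta_le (b := c) h0 hσ1 hε0 hε1
  obtain ⟨C₂, hC₂, hb₂⟩ := hf.exists_norm_mellin_le h0 hσc hc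
  -- Near the pole the bounds on `ζ` and on the polar part are unavailable, but `H` is entire and
  -- hence bounded on this box.
  have hcomp : IsCompact (Icc σ c ×ℂ Icc (-1) 1) := isCompact_Icc.reProdIm isCompact_Icc
  obtain ⟨M, hM⟩ := hcomp.exists_bound_of_continuousOn hH.continuous.continuousOn
  have hM0 : 0 ≤ M := (norm_nonneg _).trans (hM (σ : ℂ) (by simp [mem_reProdIm, hσc]))
  set A := ∑ r ∈ Finset.range k, |(zetaPoly k ^ k).coeff r| with hA
  have hA0 : 0 ≤ A := Finset.sum_nonneg fun _ _ => abs_nonneg _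
  have hbH : ∀ s : ℂ, σ ≤ s.re → s.re ≤ c →
      ‖H s‖ ≤ (C₁ ^ k + A + M) * (1 + |s.im|) ^ (θ * k) := fun s hs₁ hs₂ => by
    have hone : 1 ≤ (1 + |s.im|) ^ (θ * k) :=
      Real.one_le_rpow (by linarith [abs_nonneg s.im]) hθ0
    rcases le_total 1 |s.im| with ht | ht
    · have hne : s ≠ 1 := fun h => by norm_num [h] at ht
      have hHs : H s = riemannZeta s ^ k - polarPart k s := by rw [hζ s hne]; ring
      have hz : ‖riemannZeta s ^ k‖ ≤ C₁ ^ k * (1 + |s.im|) ^ (θ * k) := by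
        rw [norm_pow, Real.rpow_mul (by positivity), Real.rpow_natCast, ← mul_pow]
        exact pow_le_pow_left₀ (norm_nonneg _) (hb₁ s hs₁ hs₂ ht) k
      rw [hHs]
      refine (norm_sub_le _ _).trans ((add_le_add hz (norm_polarPart_le k ht)).trans ?_)
      rw [← hA]
      nlinarith
    · have := hM s ⟨⟨hs₁, hs₂⟩, abs_le.mp ht⟩
      have : 0 ≤ C₁ ^ k := pow_nonneg hC₁ k
      nlinarith
  refine ⟨C₂ * (C₁ ^ k + A + M), 2 - θ * k, by linarith, fun s hs₁ hs₂ => ?_⟩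
  rw [norm_mul, neg_sub, sub_eq_neg_add, Real.rpow_add (by positivity)]
  refine (mul_le_mul (hb₂ s hs₁ hs₂) (hbH s hs₁ hs₂) (norm_nonneg _) (by positivity)).trans
    (le_of_eq ?_)
  ring

theorem mellinInv_congr {Φ Ψ : ℂ → ℂ} {σ : ℝ} (h : ∀ s : ℂ, s.re = σ → Φ s = Ψ s) (x : ℝ) :
    mellinInv σ Φ x = mellinInv σ Ψ x := by
  have : ∀ t : ℝ, Φ (σ + t * I) = Ψ (σ + t * I) := fun t => h _ (by simp)
  simp only [mellinInv, this]

theorem verticalIntegrable_congr {Φ Ψ : ℂ → ℂ} {σ : ℝ} (h : ∀ s : ℂ, s.re = σ → Φ s = Ψ s)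
    (hΦ : VerticalIntegrable Φ σ) : VerticalIntegrable Ψ σ :=
  hΦ.congr (Eventually.of_forall fun t => h _ (by simp))

theorem MuntzClass.continuous_mellin (hf : MuntzClass α f) {σ : ℝ} (h0 : 0 < σ) (hα : σ < α) :
    Continuous fun t : ℝ => mellin f (σ + t * I) :=
  continuous_iff_continuousAt.mpr fun t =>
    ContinuousAt.comp (f := fun t : ℝ => (σ + t * I : ℂ))
      (hf.differentiableAt_mellin (by simpa using h0) (by simpa using hα)).continuousAt
      (by fun_prop)

/-- Stated for a general measure so that counting measure gives the divisor sum and restricted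
Lebesgue measure gives the integrals of `P_{k-1}`. -/
theorem MuntzClass.integral_mul_comp_mul {Y : Type*} [MeasurableSpace Y] {μ : Measure Y} [SFinite μ]
    (hf : MuntzClass α f) {σ : ℝ} (h0 : 0 < σ) (hα : σ < α)
    {w : Y → ℂ} {p : Y → ℝ} (hw : AEStronglyMeasurable w μ) (hp : Measurable p)
    (hpos : ∀ᵐ y ∂μ, 0 < p y) {W : ℂ → ℂ}
    (hW : ∀ s : ℂ, s.re = σ → Integrable (fun y => w y * (p y : ℂ) ^ (-s)) μ ∧
      ∫ y, w y * (p y : ℂ) ^ (-s) ∂μ = W s) {x : ℝ} (hx : 0 < x) :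
    Integrable (fun y => w y * f (x * p y)) μ ∧
    VerticalIntegrable (fun s => mellin f s * W s) σ ∧
    ∫ y, w y * f (x * p y) ∂μ = mellinInv σ (fun s => mellin f s * W s) x := by
  obtain ⟨C, -, hC⟩ := hf.exists_norm_mellin_le h0 le_rfl hα
  have hF : VerticalIntegrable (mellin f) σ :=
    verticalIntegrable_of_norm_le one_lt_two (hf.continuous_mellin h0 hα) fun t => by
      simpa using hC (σ + t * I) (by simp) (by simp)
  have hcongr : ∀ s : ℂ, s.re = σ →
      mellin f s * ∫ y, w y * (p y : ℂ) ^ (-s) ∂μ = mellin f s * W s := fun s hs => by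
    rw [(hW s hs).2]
  obtain ⟨h₁, h₂, h₃⟩ := integral_comp_mul_eq_mellinInv
    (hf.mellinConvergent (by simpa using h0) (by simpa using hα)) hF
    (hf.continuousOn.mono Ioi_subset_Ici_self) hw hp hpos (hW σ (by simp)).1 hx
  exact ⟨h₁, verticalIntegrable_congr hcongr h₂, h₃.trans (mellinInv_congr hcongr x)⟩

theorem MuntzClass.tsum_divisorFun (hf : MuntzClass α f) (k : ℕ) {c : ℝ} (h1 : 1 < c) (hα : c < α)
    {x : ℝ} (hx : 0 < x) :
    Summable (fun n : ℕ+ => (divisorFun k (n : ℕ) : ℂ) * f (((n : ℕ) : ℝ) * x)) ∧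
    VerticalIntegrable (fun s => mellin f s * riemannZeta s ^ k) c ∧
    ∑' n : ℕ+, (divisorFun k (n : ℕ) : ℂ) * f (((n : ℕ) : ℝ) * x) =
      mellinInv c (fun s => mellin f s * riemannZeta s ^ k) x := by
  have hc0 : 0 < c := one_pos.trans h1
  let : MeasurableSpace ℕ+ := ⊤
  have : DiscreteMeasurableSpace ℕ+ := ⟨fun _ => trivial⟩
  obtain ⟨h₁, h₂, h₃⟩ := hf.integral_mul_comp_mul (μ := (Measure.count : Measure ℕ+)) hc0 hα
    (w := fun n => (divisorFun k (n : ℕ) : ℂ)) (p := fun n => ((n : ℕ) : ℝ))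
    (W := fun s => riemannZeta s ^ k)
    (measurable_of_countable _).aestronglyMeasurable (measurable_of_countable _)
    (Eventually.of_forall fun n => by exact_mod_cast PNat.pos n) (fun s hs => by
      have := hasSum_divisorFun k (s := s) (by rw [hs]; exact h1)
      have hi := integrable_count_iff.mpr this.summable.norm
      exact ⟨hi, by rw [integral_countable hi]; simpa using this.tsum_eq⟩) hx
  have e : ∀ n : ℕ+, f (x * ((n : ℕ) : ℝ)) = f (((n : ℕ) : ℝ) * x) := fun n => by rw [mul_comm]
  simp only [e] at h₁ h₃
  refine ⟨(integrable_count_iff.mp h₁).of_norm, h₂, ?_⟩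
  rw [← h₃, integral_countable h₁]
  simp

theorem MuntzClass.integral_polyP (hf : MuntzClass α f) {k : ℕ} {S : Set ℝ} {σ : ℝ} (h0 : 0 < σ)
    (hα : σ < α) (hS : MeasurableSet S) (hpos : S ⊆ Ioi 0) {W : ℂ → ℂ}
    (hW : ∀ s : ℂ, s.re = σ →
      IntegrableOn (fun y : ℝ => (((polyP k).eval (Real.log y) : ℝ) : ℂ) * (y : ℂ) ^ (-s)) S ∧
      ∫ y in S, (((polyP k).eval (Real.log y) : ℝ) : ℂ) * (y : ℂ) ^ (-s) = W s)
    {x : ℝ} (hx : 0 < x) :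
    IntegrableOn (fun y : ℝ => f (x * y) * (((polyP k).eval (Real.log y) : ℝ) : ℂ)) S ∧
    VerticalIntegrable (fun s => mellin f s * W s) σ ∧
    ∫ y in S, f (x * y) * (((polyP k).eval (Real.log y) : ℝ) : ℂ) =
      mellinInv σ (fun s => mellin f s * W s) x := by
  have hm : Measurable fun y : ℝ => (((polyP k).eval (Real.log y) : ℝ) : ℂ) :=
    measurable_ofReal.comp ((polyP k).continuous.measurable.comp Real.measurable_log)
  have := hf.integral_mul_comp_mul (μ := volume.restrict S) h0 hα hm.aestronglyMeasurable
    measurable_id (ae_restrict_of_forall_mem hS fun y hy => hpos hy) hW hx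
  simpa only [IntegrableOn, id, mul_comm (f _)] using this

theorem MuntzClass.integrableOn_polyP (hα : 1 < α) (hf : MuntzClass α f) {k : ℕ} (hk : 1 ≤ k)
    {x : ℝ} (hx : 0 < x) :
    IntegrableOn (fun y : ℝ => f (x * y) * (((polyP k).eval (Real.log y) : ℝ) : ℂ)) (Ioi 0) := by
  rw [← Ioc_union_Ioi_eq_Ioi zero_le_one]
  refine IntegrableOn.union ?_ ?_
  · exact (hf.integral_polyP (σ := 1 / 2) (by norm_num) (by linarith) measurableSet_Ioc
      Ioc_subset_Ioi_self (fun s hs => integral_Ioc_polyP_mul_cpow hk (by rw [hs]; norm_num)) hx).1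
  · exact (hf.integral_polyP (σ := (1 + α) / 2) (by linarith) (by linarith) measurableSet_Ioi
      (Ioi_subset_Ioi zero_le_one)
      (fun s hs => integral_Ioi_polyP_mul_cpow hk (by rw [hs]; linarith)) hx).1

theorem MuntzClass.voronoi_eq_mellinInv (hα : 1 < α) (hf : MuntzClass α f) {k : ℕ} (hk : 1 ≤ k)
    {σ : ℝ} (h0 : 0 < σ) (hσk : 1 - 2 / (k : ℝ) < σ) (h1 : σ < 1) {x : ℝ} (hx : 0 < x) :
    VerticalIntegrable (fun s => riemannZeta s ^ k * mellin f s) σ ∧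
    voronoi k f x = mellinInv σ (fun s => riemannZeta s ^ k * mellin f s) x := by
  obtain ⟨H, hH, hζ⟩ := exists_riemannZeta_pow_eq k
  set c := (1 + α) / 2 with hc
  have h1c : 1 < c := by linarith
  have hcα : c < α := by linarith
  have hσc : σ ≤ c := by linarith
  obtain ⟨C, r, hr, hb⟩ := hf.exists_norm_mellin_mul_le hk hH hζ h0 hσk h1.le hσc hcα
  have hdiff : DifferentiableOn ℂ (fun s => mellin f s * H s) (re ⁻¹' Icc σ c) := fun s hs =>
    ((hf.differentiableAt_mellin (h0.trans_le hs.1) (hs.2.trans_lt hcα)).mul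
      (hH s)).differentiableWithinAt
  have hne : ∀ τ : ℝ, τ ≠ 1 → ∀ s : ℂ, s.re = τ → s ≠ 1 := fun τ hτ s hs h => hτ (by
    rw [← hs, h, one_re])
  obtain ⟨-, hS₂, hS₃⟩ := hf.tsum_divisorFun k h1c hcα hx
  obtain ⟨hA₁, hA₂, hA₃⟩ := hf.integral_polyP (S := Ioi 1) (h0.trans_le hσc) hcα measurableSet_Ioi
    (Ioi_subset_Ioi zero_le_one)
    (fun s hs => integral_Ioi_polyP_mul_cpow hk (by rw [hs]; exact h1c)) hx
  obtain ⟨hB₁, hB₂, hB₃⟩ := hf.integral_polyP (S := Ioc 0 1) h0 (h1.trans hα) measurableSet_Ioc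
    Ioc_subset_Ioi_self (fun s hs => integral_Ioc_polyP_mul_cpow hk (by rw [hs]; exact h1)) hx
  have hHσ : VerticalIntegrable (fun s => mellin f s * H s) σ := by
    refine verticalIntegrable_of_norm_le (C := C) hr (hdiff.continuousOn.comp_continuous (by fun_prop)
      fun t => by simpa using hσc) fun t => ?_
    simpa using hb (σ + t * I) (by simp) (by simpa using hσc)
  have hcongr : ∀ s : ℂ, s.re = σ → mellin f s * H s - mellin f s * (-1 * polarPart k s) =
      riemannZeta s ^ k * mellin f s := fun s hs => by
    rw [hζ s (hne σ h1.ne s hs)]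
    ring
  refine ⟨verticalIntegrable_congr hcongr (Integrable.sub hHσ hB₂), ?_⟩
  -- On `Re s = c` the polar part cancels the pole of `ζ^k`, so the difference can be moved to `Re s
  -- = σ`; the integral over `(0, 1]` is represented on the line `σ` only.
  have hSA : mellinInv c (fun s => mellin f s * riemannZeta s ^ k) x -
      mellinInv c (fun s => mellin f s * (1 * polarPart k s)) x =
        mellinInv σ (fun s => mellin f s * H s) x := by
    rw [mellinInv_eq_of_norm_le hσc hr hdiff hb hx, ← mellinInv_sub hS₂ hA₂ hx]
    refine mellinInv_congr (fun s hs => ?_) x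
    rw [hζ s (hne c h1c.ne' s hs)]
    ring
  rw [← mellinInv_congr hcongr, mellinInv_sub hHσ hB₂ hx, ← hSA, voronoi, hS₃, ← hB₃, ← hA₃,
    ← Ioc_union_Ioi_eq_Ioi (zero_le_one' ℝ), setIntegral_union (Ioc_disjoint_Ioi le_rfl)
    measurableSet_Ioi hB₁ hA₁]
  ring

theorem MuntzClass.hasMellin_voronoi (hα : 1 < α) (hf : MuntzClass α f) {k : ℕ} (hk : 1 ≤ k)
    {s : ℂ} (hs₀ : max 0 (1 - 2 / (k : ℝ)) < s.re) (hs₁ : s.re < 1) :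
    HasMellin (voronoi k f) s (riemannZeta s ^ k * mellin f s) := by
  have key : ∀ σ ∈ Ioo (max 0 (1 - 2 / (k : ℝ))) 1, ∀ x : ℝ, 0 < x → _ := fun σ hσ x hx =>
    hf.voronoi_eq_mellinInv hα hk (max_lt_iff.mp hσ.1).1 (max_lt_iff.mp hσ.1).2 hσ.2 hx
  refine hasMellin_of_eq_mellinInv (Φ := fun s => riemannZeta s ^ k * mellin f s)
    (fun σ hσ => ?_) (fun σ hσ => (key σ hσ 1 one_pos).1)
    (fun σ hσ x hx => (key σ hσ x hx).2) hs₀ hs₁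
  refine Continuous.mul (Continuous.pow (continuous_iff_continuousAt.mpr fun t => ?_) k)
    (hf.continuous_mellin (max_lt_iff.mp hσ.1).1 (hσ.2.trans hα))
  refine ContinuousAt.comp (f := fun t : ℝ => (σ + t * I : ℂ))
    (differentiableAt_riemannZeta fun h => hσ.2.ne ?_).continuousAt (by fun_prop)
  simpa using congrArg re h

end Muntz

end Muntz

theorem theorem10 (α : ℝ) (hα : 1 < α) (f : ℝ → ℂ) (hf : Muntz.MuntzClass α f)
    (k : ℕ) (hk : 1 ≤ k) :
    (∀ x : ℝ, 0 < x →
      Summable (fun n : ℕ+ => (Muntz.divisorFun k (n : ℕ) : ℂ) * f (((n : ℕ) : ℝ) * x)) ∧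
      MeasureTheory.IntegrableOn
        (fun y : ℝ => f (x * y) * (((Muntz.polyP k).eval (Real.log y) : ℝ) : ℂ)) (Set.Ioi 0)) ∧
    ∀ s : ℂ, max 0 (1 - 2 / (k : ℝ)) < s.re → s.re < 1 →
      MellinConvergent f s ∧
      HasMellin (Muntz.voronoi k f) s (riemannZeta s ^ k * mellin f s) := by
  refine ⟨fun x hx => ⟨?_, hf.integrableOn_polyP hα hk hx⟩, fun s hs₀ hs₁ => ⟨?_, ?_⟩⟩
  · exact (hf.tsum_divisorFun k (c := (1 + α) / 2) (by linarith) (by linarith) hx).1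
  · exact hf.mellinConvergent (max_lt_iff.mp hs₀).1 (hs₁.trans hα)
  · exact hf.hasMellin_voronoi hα hk hs₀ hs₁
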